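/- Let $\mathcal H\neq\{0\}$ be a complex Hilbert space and $S(t)$, $t\ge 0$, a strongly continuous semigroup of bounded operators on $\mathcal H$ with generator $A$. Let $\omega\in\mathbb R$ be such that the half-plane $\{\mathrm{Re}\, z\ge\omega\}$ is contained in the resolvent set of $A$ and $\|(z-A)^{-1}\|$ is bounded there, and define $r=r(\omega)>0$ by $\frac1r=\sup_{\mathrm{Re}\, z>\omega}\|(z-A)^{-1}\|$. Let $m$ be a continuous positive function on $[0,\infty)$ with $\|S(t)\|\le m(t)$ for all $t\ge 0$. Let $a,b>0$, and let $\Phi\in C([0,a];\mathbb R)$, $\Psi\in C([0,b];\mathbb R)$ be increasing and piecewise $C^1$ (that is, the derivative exists and is continuous off a finite set and has finite one-sided limits everywhere), with $\Phi(0)=\Psi(0)=0$, $\Phi>0$ on $(0,a]$, $\Psi>0$ on $(0,b]$, and $$r^2\Phi^2-\Phi'^2\le 0\ \text{ on }[0,a],\qquad r^2\Psi^2-\Psi'^2\le 0\ \text{ on }[0,b]$$ wherever the derivatives exist. Write $x_-=\max(-x,0)$, $\|f\|_{e^{\omega\cdot}L^2([0,a])}=\|e^{-\omega\cdot}f\|_{L^2([0,a])}$,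 and, for $\tau>0$, $$J_{\max}(\tau)=e^{\sqrt{1+(r\tau)^2}-1}\,\frac{2}{\tau}\left(\sqrt{1+(r\tau)^2}-1\right).$$ Then for every $t>a+b$, $$e^{-\omega t}\|S(t)\|\le\frac{\|(r^2\Phi^2-\Phi'^2)_-^{1/2}m\|_{e^{\omega\cdot}L^2([0,a])}\,\|(r^2\Psi^2-\Psi'^2)_-^{1/2}m\|_{e^{\omega\cdot}L^2([0,b])}}{J_{\max}(t-a-b)\,\Phi(a)\Psi(b)}.$$ Moreover $$J_{\max}(\tau)=\left(1+O\left(\frac1{r\tau}\right)\right)\frac2e\,r\,e^{r\tau},\qquad r\tau\to+\infty,$$ and in particular, for large values of $r(t-a-b)$, $$e^{-\omega t}\|S(t)\|\le\left(1+O\left(\frac1{r(t-a-b)}\right)\right)\frac{e}{2r}\,e^{-r(t-a-b)}\,\frac{\|(r^2\Phi^2-\Phi'^2)_-^{1/2}m\|_{e^{\omega\cdot}L^2([0,a])}\,\|(r^2\Psi^2-\Psi'^2)_-^{1/2}m\|_{e^{\omega\cdot}L^2([0,b])}}{\Phi(a)\Psi(b)}.$$ Here the thresholds for "large" and the constants in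 the $O$-terms are absolute. -/

import Mathlib

open Set Filter Topology

/-- A strongly continuous semigroup `S(t)`, `t ≥ 0`, of bounded operators on `H`.
The values at negative times are irrelevant. -/
structure StronglyContinuousSemigroup (H : Type*) [NormedAddCommGroup H]
    [InnerProductSpace ℂ H] where
  toFun : ℝ → H →L[ℂ] H
  map_zero : toFun 0 = ContinuousLinearMap.id ℂ H
  map_add : ∀ s t : ℝ, 0 ≤ s → 0 ≤ t → toFun (s + t) = (toFun s).comp (toFun t)
  continuousOn : ∀ x : H, ContinuousOn (fun t => toFun t x) (Ici 0)

namespace StronglyContinuousSemigroup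

/-- `y` is the right derivative at `0` of the orbit `t ↦ S(t) x`. -/
def HasGeneratorValue {H : Type*} [NormedAddCommGroup H] [InnerProductSpace ℂ H]
    (S : StronglyContinuousSemigroup H) (x y : H) : Prop :=
  Tendsto (fun h : ℝ => (h : ℂ)⁻¹ • (S.toFun h x - x)) (𝓝[>] 0) (𝓝 y)

theorem HasGeneratorValue.add {H : Type*} [NormedAddCommGroup H] [InnerProductSpace ℂ H]
    {S : StronglyContinuousSemigroup H} {x y x₁ y₁ : H} (hx : S.HasGeneratorValue x y)
    (hx₁ : S.HasGeneratorValue x₁ y₁) : S.HasGeneratorValue (x + x₁) (y + y₁) := by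
  unfold HasGeneratorValue at *
  refine (Tendsto.add hx hx₁).congr fun h => ?_
  rw [_root_.map_add, ← smul_add]
  congr 1
  abel

theorem HasGeneratorValue.smul {H : Type*} [NormedAddCommGroup H] [InnerProductSpace ℂ H]
    {S : StronglyContinuousSemigroup H} {x y : H} (c : ℂ) (hx : S.HasGeneratorValue x y) :
    S.HasGeneratorValue (c • x) (c • y) := by
  unfold HasGeneratorValue at *
  refine (Tendsto.const_smul hx c).congr fun h => ?_
  rw [map_smul, ← smul_sub, smul_comm]

theorem HasGeneratorValue.unique {H : Type*} [NormedAddCommGroup H] [InnerProductSpace ℂ H]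
    {S : StronglyContinuousSemigroup H} {x y y₁ : H} (hx : S.HasGeneratorValue x y)
    (hx₁ : S.HasGeneratorValue x y₁) : y = y₁ :=
  tendsto_nhds_unique hx hx₁

/-- The generator `A` of the semigroup, as an unbounded operator on `H`. Its domain is the set of
`x` for which the orbit `t ↦ S(t) x` has a right derivative at `0`, and `A x` is that derivative. -/
noncomputable def generator {H : Type*} [NormedAddCommGroup H] [InnerProductSpace ℂ H]
    (S : StronglyContinuousSemigroup H) : H →ₗ.[ℂ] H where
  domain :=
    { carrier := {x | ∃ y, S.HasGeneratorValue x y}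
      add_mem' := fun ⟨y, hy⟩ ⟨y₁, hy₁⟩ => ⟨y + y₁, hy.add hy₁⟩
      zero_mem' := ⟨0, by simp [HasGeneratorValue]⟩
      smul_mem' := fun c _ ⟨y, hy⟩ => ⟨c • y, hy.smul c⟩ }
  toFun :=
    { toFun := fun x => Classical.choose x.2
      map_add' := fun x x₁ => HasGeneratorValue.unique (Classical.choose_spec (x + x₁).2)
        ((Classical.choose_spec x.2).add (Classical.choose_spec x₁.2))
      map_smul' := fun c x => HasGeneratorValue.unique (Classical.choose_spec (c • x).2)
        ((Classical.choose_spec x.2).smul c) }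

end StronglyContinuousSemigroup

/-- The bounded operator `R` is a two-sided inverse of `z - A : D(A) → H`. -/
def IsResolventAt {H : Type*} [NormedAddCommGroup H] [InnerProductSpace ℂ H]
    (A : H →ₗ.[ℂ] H) (z : ℂ) (R : H →L[ℂ] H) : Prop :=
  (∀ x : H, ∃ hx : R x ∈ A.domain, z • R x - A ⟨R x, hx⟩ = x) ∧
    ∀ x : A.domain, R (z • (x : H) - A x) = x

/-- The resolvent set `ρ(A)` of an unbounded operator `A`. -/
def unboundedResolventSet {H : Type*} [NormedAddCommGroup H] [InnerProductSpace ℂ H]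
    (A : H →ₗ.[ℂ] H) : Set ℂ :=
  {z | ∃ R : H →L[ℂ] H, IsResolventAt A z R}

open Classical in
/-- The resolvent `(z - A)⁻¹`, for `z ∈ ρ(A)` (and `0` for other `z`). -/
noncomputable def unboundedResolvent {H : Type*} [NormedAddCommGroup H] [InnerProductSpace ℂ H]
    (A : H →ₗ.[ℂ] H) (z : ℂ) : H →L[ℂ] H :=
  if h : ∃ R : H →L[ℂ] H, IsResolventAt A z R then Classical.choose h else 0

/-- The half-plane `Re z ≥ ω` is contained in `ρ(A)` and the norm of `(z - A)⁻¹` is uniformly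
bounded there. -/
def ResolventBoundedOn {H : Type*} [NormedAddCommGroup H] [InnerProductSpace ℂ H]
    (A : H →ₗ.[ℂ] H) (ω : ℝ) : Prop :=
  (∀ z : ℂ, ω ≤ z.re → z ∈ unboundedResolventSet A) ∧
    ∃ K : ℝ, ∀ z : ℂ, ω ≤ z.re → ‖unboundedResolvent A z‖ ≤ K

/-- The number `r(ω)`, given by `1 / r(ω) = sup_{Re z > ω} ‖(z - A)⁻¹‖`. -/
noncomputable def resolventRadius {H : Type*} [NormedAddCommGroup H] [InnerProductSpace ℂ H]
    (A : H →ₗ.[ℂ] H) (ω : ℝ) : ℝ :=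
  (⨆ z : {z : ℂ // ω < z.re}, ‖unboundedResolvent A z‖)⁻¹

/-- `f` is continuous on `[a, b]` and piecewise `C¹`: its derivative exists and is continuous off
a finite set, and has (finite) one-sided limits everywhere on `[a, b]`. -/
def PiecewiseC1On (f : ℝ → ℝ) (a b : ℝ) : Prop :=
  ContinuousOn f (Icc a b) ∧
    (∃ P : Finset ℝ, ∀ s ∈ Ioo a b, s ∉ P → DifferentiableAt ℝ f s ∧ ContinuousAt (deriv f) s) ∧
    (∀ s ∈ Ico a b, ∃ l : ℝ, Tendsto (deriv f) (𝓝[>] s) (𝓝 l)) ∧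
    ∀ s ∈ Ioc a b, ∃ l : ℝ, Tendsto (deriv f) (𝓝[<] s) (𝓝 l)

/-- Prescribed weights on `[0, a]`: `Φ` is continuous, increasing and piecewise `C¹` on `[0, a]`,
`Φ(0) = 0`, `Φ > 0` on `]0, a]` (so that `Φ = e^φ` with `φ` real) and `r² Φ² - Φ'² ≤ 0` wherever
`Φ'` exists. -/
structure IsAdmissibleWeight (r a : ℝ) (Φ : ℝ → ℝ) : Prop where
  piecewiseC1 : PiecewiseC1On Φ 0 a
  monotoneOn : MonotoneOn Φ (Icc 0 a)
  map_zero : Φ 0 = 0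
  pos : ∀ s ∈ Ioc 0 a, 0 < Φ s
  sq_le : ∀ s ∈ Ioo 0 a, DifferentiableAt ℝ Φ s → r ^ 2 * Φ s ^ 2 - deriv Φ s ^ 2 ≤ 0

/-- The norm of `f` in `e^{ω ·} L²([0, a])`, that is, the norm of `e^{-ω ·} f` in `L²([0, a])`. -/
noncomputable def weightedNorm (ω a : ℝ) (f : ℝ → ℝ) : ℝ :=
  Real.sqrt (∫ s in (0 : ℝ)..a, (Real.exp (-ω * s) * f s) ^ 2)

/-- The function `(r² Φ² - Φ'²)_-^{1/2} m`, with `x_- = max (-x) 0`. -/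
noncomputable def negPartWeight (r : ℝ) (Φ m : ℝ → ℝ) (s : ℝ) : ℝ :=
  Real.sqrt (max (-(r ^ 2 * Φ s ^ 2 - deriv Φ s ^ 2)) 0) * m s

/-- `J_max(t) = e^{√(1 + (rt)²) - 1} (2 / t) (√(1 + (rt)²) - 1)`. -/
noncomputable def Jmax (r t : ℝ) : ℝ :=
  Real.exp (Real.sqrt (1 + (r * t) ^ 2) - 1) * (2 / t) * (Real.sqrt (1 + (r * t) ^ 2) - 1)

/-!
The proof is an energy argument along orbits. Write `U` for an orbit `s ↦ S(s) x`, or for an orbit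
`s ↦ S(s)* y` of the adjoint semigroup, and `E_ω(s) = (e^{-ω s} ‖U(s)‖)²` (`energyDensity`). The
crux is that

  `∫_0^T (r² χ² - χ'²) E_ω ≤ 0`  whenever `χ(0) = 0`  (`integral_weight_mul_energyDensity_nonpos`).

If also `χ(T) = 0`, then `χ U` solves `(∂ - A)(χ U) = χ' U` with vanishing boundary values, so that
the Fourier coefficients on `[0, T]` of `e^{-ω s} χ U` are the images of those of `e^{-ω s} χ' U`
under the resolvents `(z - A)⁻¹`, `Re z = ω`, whose norms are at most `1 / r`; Parseval's identity
for Hilbert space valued functions (`tsum_enorm_fourierCoeffOn_sq`) gives the inequality. For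
general `χ(T)`, one extends `χ` to `[T, N]` by a multiple of `sinh (r (N - s))`, for which
`r² χ² - χ'²` is a negative constant of order `e^{-2 r N}`, and lets `N → ∞`. The error vanishes as
soon as `∫_0^N E_ω = o(e^{2 r N})`, which holds if `∫_0^∞ E_{ω + r/2}` is finite. In that case the
choice `χ(s) = s` shows that `∫_0^∞ E_ω` is finite too. Starting from the crude exponential bound on the
semigroup, one descends in steps of `r / 2` to any weight greater than `ω` (`exists_energy_bound`),
and the inequality at `ω` itself follows by continuity.

To conclude, `Φ` is continued beyond `a` by `Φ(a) e^{κ (s - a)}`, and `Ψ` beyond `b` likewise, with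
`κ < r`. This bounds `∫_a^{t-b} e^{2κ(s-a)} E_ω` for the orbit of `x` by the weighted norm on
`[0, a]`, and similarly for the adjoint orbit of `y`. Since
`⟨y, S(t) x⟩ = ⟨S(t - s)* y, S(s) x⟩` does not depend on `s`, the Cauchy–Schwarz inequality on
`[a, t - b]` bounds `⟨y, S(t) x⟩`, with the constant `(r² - κ²) τ e^{κ τ}`, `τ = t - a - b`, in the
denominator. Its maximum over `κ`, attained at `κ = (√(1 + (rτ)²) - 1) / τ`, is `Jmax r τ`
(`norm_inner_mul_Jmax_le`). Only vectors `y` in the dense range of the adjoint of a resolvent are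
used, because their adjoint orbits are easily seen to be continuous.
-/

section

open MeasureTheory ENNReal
open ContinuousLinearMap (adjoint)

/-! ### Parseval's identity in a Hilbert space -/

theorem HilbertBasis.tsum_enorm_inner_sq {ι H : Type*} [NormedAddCommGroup H]
    [InnerProductSpace ℂ H] (e : HilbertBasis ι ℂ H) (x : H) :
    ∑' i, ‖inner ℂ (e i) x‖ₑ ^ 2 = ‖x‖ₑ ^ 2 := by
  have h := Complex.hasSum_re (e.hasSum_inner_mul_inner x x)
  have h2 : (fun i => (inner ℂ x (e i) * inner ℂ (e i) x).re)
      = fun i => ‖inner ℂ (e i) x‖ ^ 2 := by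
    funext i
    rw [← inner_conj_symm, mul_comm, Complex.mul_conj, Complex.ofReal_re, Complex.normSq_eq_norm_sq]
  have h3 : (inner ℂ x x).re = ‖x‖ ^ 2 := by
    rw [inner_self_eq_norm_sq_to_K]; norm_cast
  rw [h2, h3] at h
  have h4 := ENNReal.ofReal_tsum_of_nonneg (fun i => by positivity) h.summable
  rw [h.tsum_eq] at h4
  simpa [ENNReal.ofReal_pow] using h4.symm

theorem tsum_enorm_fourierCoeffOn_sq_complex {a b : ℝ} (hab : a < b) {f : ℝ → ℂ}
    (hf : MemLp f 2 (volume.restrict (Ioc a b))) :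
    ∑' n, ‖fourierCoeffOn hab f n‖ₑ ^ 2
      = ENNReal.ofReal (b - a)⁻¹ * ∫⁻ s in Ioc a b, ‖f s‖ₑ ^ 2 := by
  have h := hasSum_sq_fourierCoeffOn hab hf
  have h4 := ENNReal.ofReal_tsum_of_nonneg (fun i => by positivity) h.summable
  have h5 : Integrable (fun s => ‖f s‖ ^ 2) (volume.restrict (Ioc a b)) :=
    hf.integrable_norm_pow (by norm_num)
  rw [h.tsum_eq, smul_eq_mul, ENNReal.ofReal_mul (by rw [inv_nonneg]; linarith),
    intervalIntegral.integral_of_le hab.le,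
    ofReal_integral_eq_lintegral_ofReal h5 (ae_of_all _ fun s => by positivity)] at h4
  simpa [ENNReal.ofReal_pow] using h4.symm

theorem inner_fourierCoeffOn {H : Type*} [NormedAddCommGroup H] [InnerProductSpace ℂ H]
    [CompleteSpace H] {a b : ℝ} (hab : a < b) {f : ℝ → H}
    (hf : IntervalIntegrable f volume a b) (e : H) (n : ℤ) :
    inner ℂ e (fourierCoeffOn hab f n) = fourierCoeffOn hab (fun s => inner ℂ e (f s)) n := by
  rw [fourierCoeffOn_eq_integral, fourierCoeffOn_eq_integral, inner_smul_right_eq_smul]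
  congr 1
  have := (innerSL ℂ e).intervalIntegral_comp_comm (μ := volume) (a := a) (b := b)
    (f := fun s : ℝ => fourier (-n) (s : AddCircle (b - a)) • f s) ?_
  · simpa [inner_smul_right] using this.symm
  · refine hf.continuousOn_smul (Continuous.continuousOn ?_)
    exact (fourier (-n)).continuous.comp (AddCircle.continuous_mk' _)

/-- **Parseval's identity** for square integrable functions with values in a Hilbert space, which
need not be separable. It follows from the scalar case by expanding in a Hilbert basis. -/
theorem tsum_enorm_fourierCoeffOn_sq {H : Type*} [NormedAddCommGroup H] [InnerProductSpace ℂ H]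
    [CompleteSpace H] {a b : ℝ} (hab : a < b) {f : ℝ → H}
    (hf : MemLp f 2 (volume.restrict (Ioc a b))) :
    ∑' n, ‖fourierCoeffOn hab f n‖ₑ ^ 2
      = ENNReal.ofReal (b - a)⁻¹ * ∫⁻ s in Ioc a b, ‖f s‖ₑ ^ 2 := by
  obtain ⟨ι, e, -⟩ := exists_hilbertBasis ℂ H
  have hint : IntervalIntegrable f volume a b := by
    rw [intervalIntegrable_iff_integrableOn_Ioc_of_le hab.le]
    exact hf.integrable (by norm_num)
  have hcomp : ∀ i, MemLp (fun s => inner ℂ (e i) (f s)) 2 (volume.restrict (Ioc a b)) :=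
    fun i => (innerSL ℂ (e i)).comp_memLp' hf
  have hg := hf.aestronglyMeasurable
  set g := hg.mk f
  -- The range of `g` is separable, so only countably many coordinates of `g` do not vanish
  -- identically; this is what allows the sum over the basis to be interchanged with the integral.
  obtain ⟨D, hDc, hD⟩ := hg.stronglyMeasurable_mk.isSeparable_range
  have hJ : (⋃ d ∈ D, {i | inner ℂ (e i : H) d ≠ 0}).Countable := by
    refine hDc.biUnion fun d _ => ?_
    have h := (e.hasSum_inner_mul_inner d d).summable.countable_support
    refine h.mono fun i hi => ?_
    simp only [Function.mem_support, mem_ofPred_eq] at hi ⊢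
    refine mul_ne_zero (fun h0 => hi ?_) hi
    rw [← inner_conj_symm, h0, _root_.map_zero]
  set J := ⋃ d ∈ D, {i | inner ℂ (e i : H) d ≠ 0}
  have hJ0 : ∀ i ∉ J, ∀ s, inner ℂ (e i : H) (g s) = 0 := by
    intro i hi s
    have hcl : IsClosed {x : H | inner ℂ (e i) x = 0} :=
      isClosed_eq (by fun_prop) continuous_const
    refine hcl.closure_subset_iff.2 (fun d hd => ?_) (hD ⟨s, rfl⟩)
    by_contra h
    exact hi (mem_biUnion hd h)
  calc ∑' n, ‖fourierCoeffOn hab f n‖ₑ ^ 2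
      = ∑' n, ∑' i, ‖fourierCoeffOn hab (fun s => inner ℂ (e i) (f s)) n‖ₑ ^ 2 := by
        refine tsum_congr fun n => ?_
        rw [← e.tsum_enorm_inner_sq]
        simp_rw [inner_fourierCoeffOn hab hint]
    _ = ∑' i, ENNReal.ofReal (b - a)⁻¹ * ∫⁻ s in Ioc a b, ‖inner ℂ (e i) (f s)‖ₑ ^ 2 := by
        rw [ENNReal.tsum_comm]
        exact tsum_congr fun i => tsum_enorm_fourierCoeffOn_sq_complex hab (hcomp i)
    _ = ENNReal.ofReal (b - a)⁻¹ * ∑' i, ∫⁻ s in Ioc a b, ‖inner ℂ (e i) (g s)‖ₑ ^ 2 := by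
        rw [ENNReal.tsum_mul_left]
        congr 1
        refine tsum_congr fun i => lintegral_congr_ae ?_
        filter_upwards [hg.ae_eq_mk] with s hs
        rw [hs]
    _ = ENNReal.ofReal (b - a)⁻¹ *
          ∑' i : J, ∫⁻ s in Ioc a b, ‖inner ℂ (e (i : ι)) (g s)‖ₑ ^ 2 := by
        congr 1
        refine (tsum_subtype_eq_of_support_subset
          (f := fun i => ∫⁻ s in Ioc a b, ‖inner ℂ (e i) (g s)‖ₑ ^ 2) fun i hi => ?_).symm
        by_contra h
        exact hi (by simp [hJ0 i h])
    _ = ENNReal.ofReal (b - a)⁻¹ *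
          ∫⁻ s in Ioc a b, ∑' i : J, ‖inner ℂ (e (i : ι)) (g s)‖ₑ ^ 2 := by
        have : Countable J := hJ
        rw [lintegral_tsum fun i => ?_]
        have := hg.stronglyMeasurable_mk
        exact (((innerSL ℂ (e (i : ι))).continuous.comp_stronglyMeasurable this).enorm.pow_const
          2).aemeasurable
    _ = ENNReal.ofReal (b - a)⁻¹ * ∫⁻ s in Ioc a b, ‖f s‖ₑ ^ 2 := by
        congr 1
        refine lintegral_congr_ae ?_
        filter_upwards [hg.ae_eq_mk] with s hs
        rw [hs, ← e.tsum_enorm_inner_sq]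
        refine tsum_subtype_eq_of_support_subset
          (f := fun i => ‖inner ℂ (e i) (g s)‖ₑ ^ 2) fun i hi => ?_
        by_contra h
        exact hi (by simp [hJ0 i h])

/-! ### Piecewise differentiable weights -/

/-- `χ` is continuous on `[c, d]` and has there the derivative `g`, off a countable set; `g` is
measurable and bounded on `[c, d]`. The derivative is carried as a separate function in order that
such pairs can be glued without caring about the values of `deriv` at the junctions. -/
structure IsPrimitiveOn (χ g : ℝ → ℝ) (c d : ℝ) : Prop where
  continuousOn : ContinuousOn χ (Icc c d)
  hasDerivAt : ∃ P : Set ℝ, P.Countable ∧ ∀ s ∈ Ioo c d \ P, HasDerivAt χ (g s) s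
  measurable : Measurable g
  bounded : ∃ B, ∀ s ∈ Icc c d, |g s| ≤ B

theorem intervalIntegrable_of_measurable_of_bounded {g : ℝ → ℝ} {c d B : ℝ} (hcd : c ≤ d)
    (hg : Measurable g) (hB : ∀ s ∈ Icc c d, |g s| ≤ B) : IntervalIntegrable g volume c d := by
  rw [intervalIntegrable_iff_integrableOn_Icc_of_le hcd]
  refine Measure.integrableOn_of_bounded (M := B) (by simp) hg.aestronglyMeasurable ?_
  filter_upwards [ae_restrict_mem measurableSet_Icc] with s hs
  exact hB s hs

namespace IsPrimitiveOn

variable {χ g : ℝ → ℝ} {c d : ℝ}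

theorem intervalIntegrable (h : IsPrimitiveOn χ g c d) (hcd : c ≤ d) :
    IntervalIntegrable g volume c d :=
  have ⟨_, hB⟩ := h.bounded
  intervalIntegrable_of_measurable_of_bounded hcd h.measurable hB

theorem intervalIntegrable_sq (h : IsPrimitiveOn χ g c d) (hcd : c ≤ d) :
    IntervalIntegrable (fun s => g s ^ 2) volume c d := by
  obtain ⟨B, hB⟩ := h.bounded
  refine intervalIntegrable_of_measurable_of_bounded (B := B ^ 2) hcd (h.measurable.pow_const 2)
    fun s hs => ?_
  rw [abs_pow]
  exact pow_le_pow_left₀ (abs_nonneg _) (hB s hs) 2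

theorem glue {χ₂ g₂ : ℝ → ℝ} {e : ℝ} (h : IsPrimitiveOn χ g c d) (h₂ : IsPrimitiveOn χ₂ g₂ d e)
    (hcd : c ≤ d) (hde : d ≤ e) (heq : χ d = χ₂ d) :
    IsPrimitiveOn (fun s => if s ≤ d then χ s else χ₂ s) (fun s => if s ≤ d then g s else g₂ s)
      c e where
  continuousOn := by
    have h1 : ContinuousOn (fun s => if s ≤ d then χ s else χ₂ s) (Icc c d) :=
      h.continuousOn.congr fun s hs => by simp [hs.2]
    have h2 : ContinuousOn (fun s => if s ≤ d then χ s else χ₂ s) (Icc d e) :=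
      h₂.continuousOn.congr fun s hs => by
        rcases hs.1.eq_or_lt with rfl | hlt
        · simpa using heq
        · simp [not_le.2 hlt]
    rw [← Icc_union_Icc_eq_Icc hcd hde]
    exact h1.union_of_isClosed h2 isClosed_Icc isClosed_Icc
  hasDerivAt := by
    obtain ⟨P, hP, h1⟩ := h.hasDerivAt
    obtain ⟨Q, hQ, h2⟩ := h₂.hasDerivAt
    refine ⟨insert d (P ∪ Q), (hP.union hQ).insert d, fun s ⟨hs, hs'⟩ => ?_⟩
    simp only [mem_insert_iff, mem_union, not_or] at hs'
    rcases lt_or_gt_of_ne hs'.1 with hlt | hlt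
    · simp only [hlt.le, if_true]
      refine (h1 s ⟨⟨hs.1, hlt⟩, hs'.2.1⟩).congr_of_eventuallyEq ?_
      filter_upwards [Iio_mem_nhds hlt] with x hx
      simp [(mem_Iio.1 hx).le]
    · simp only [not_le.2 hlt, if_false]
      refine (h2 s ⟨⟨hlt, hs.2⟩, hs'.2.2⟩).congr_of_eventuallyEq ?_
      filter_upwards [Ioi_mem_nhds hlt] with x hx
      simp [not_le.2 (mem_Ioi.1 hx)]
  measurable := Measurable.ite measurableSet_Iic h.measurable h₂.measurable
  bounded := by
    obtain ⟨B, hB⟩ := h.bounded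
    obtain ⟨B₂, hB₂⟩ := h₂.bounded
    refine ⟨max B B₂, fun s hs => ?_⟩
    by_cases hsd : s ≤ d
    · simpa [hsd] using Or.inl (hB s ⟨hs.1, hsd⟩)
    · simpa [hsd] using Or.inr (hB₂ s ⟨(not_le.1 hsd).le, hs.2⟩)

theorem of_hasDerivAt (hd : ∀ s, HasDerivAt χ (g s) s) (hg : Continuous g) (c d : ℝ) :
    IsPrimitiveOn χ g c d where
  continuousOn := fun s _ => (hd s).continuousAt.continuousWithinAt
  hasDerivAt := ⟨∅, countable_empty, fun s _ => hd s⟩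
  measurable := hg.measurable
  bounded := isCompact_Icc.exists_bound_of_continuousOn hg.continuousOn

end IsPrimitiveOn

/-! ### Orbits and the energy inequality for weights vanishing at both ends -/

/-- The integrand `(e^{-ω s} ‖U(s)‖)²` of the square of the norm of `U` in `e^{ω ·} L²`. -/
noncomputable def energyDensity {H : Type*} [NormedAddCommGroup H] (U : ℝ → H) (ω s : ℝ) :
    ℝ := (Real.exp (-ω * s) * ‖U s‖) ^ 2

theorem energyDensity_nonneg {H : Type*} [NormedAddCommGroup H] (U : ℝ → H) (ω s : ℝ) :
    0 ≤ energyDensity U ω s := sq_nonneg _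

theorem continuousOn_energyDensity {H : Type*} [NormedAddCommGroup H] {U : ℝ → H}
    (hU : ContinuousOn U (Ici 0)) (ω : ℝ) :
    ContinuousOn (energyDensity U ω) (Ici 0) := by
  unfold energyDensity
  exact ((by fun_prop : ContinuousOn (fun s : ℝ => Real.exp (-ω * s)) (Ici 0)).mul hU.norm).pow 2

/-- `R` acts on the orbit `U` as the resolvent `(z - A)⁻¹`, where `A` is the generator of the
semigroup: `∫_0^t e^{-z s} U(s) ds = R (U(0) - e^{-z t} U(t))`. This integrated form of
`U' = A U` makes no reference to `A`, and so applies to the adjoint semigroup as well. -/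
def IsResolventOfOrbit {H : Type*} [NormedAddCommGroup H] [InnerProductSpace ℂ H]
    (R : H →L[ℂ] H) (z : ℂ) (U : ℝ → H) : Prop :=
  ∀ t, 0 ≤ t → ∫ s in (0 : ℝ)..t, Complex.exp (-z * s) • U s = R (U 0 - Complex.exp (-z * t) • U t)

theorem continuousOn_exp_smul {H : Type*} [NormedAddCommGroup H] [InnerProductSpace ℂ H]
    {U : ℝ → H} (hU : ContinuousOn U (Ici 0)) (z : ℂ) :
    ContinuousOn (fun s : ℝ => Complex.exp (-z * s) • U s) (Ici 0) :=
  (by fun_prop : Continuous fun s : ℝ => Complex.exp (-z * s)).continuousOn.smul hU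

/-- The function `χ U` solves `(∂ - A)(χ U) = g U`, where `g = χ'`; as it vanishes at both ends,
its Laplace transform is the image of that of `g U` under the resolvent. -/
theorem IsResolventOfOrbit.integral_smul {H : Type*} [NormedAddCommGroup H] [InnerProductSpace ℂ H]
    [CompleteSpace H] {R : H →L[ℂ] H} {z : ℂ} {U : ℝ → H} {χ g : ℝ → ℝ} {T : ℝ}
    (hR : IsResolventOfOrbit R z U) (hU : ContinuousOn U (Ici 0)) (hT : 0 ≤ T)
    (hχ : IsPrimitiveOn χ g 0 T) (h0 : χ 0 = 0) (h1 : χ T = 0) :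
    ∫ s in (0 : ℝ)..T, χ s • (Complex.exp (-z * s) • U s)
      = R (∫ s in (0 : ℝ)..T, g s • (Complex.exp (-z * s) • U s)) := by
  set E : ℝ → H := fun s => Complex.exp (-z * s) • U s
  have hE : ContinuousOn E (Ici 0) := continuousOn_exp_smul hU z
  have hE' : ContinuousOn E (uIcc 0 T) := by
    rw [uIcc_of_le hT]; exact hE.mono Icc_subset_Ici_self
  have hRE : ∀ t, 0 ≤ t → -R (E t) = (∫ s in (0 : ℝ)..t, E s) - R (U 0) := by
    intro t ht
    rw [hR t ht, map_sub]; abel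
  have hcont : ContinuousOn (fun s => -R (E s)) (Icc 0 T) :=
    (R.continuous.comp_continuousOn (hE.mono Icc_subset_Ici_self)).neg
  have hder : ∀ s ∈ Ioo 0 T, HasDerivAt (fun s => -R (E s)) (E s) s := by
    intro s hs
    have hc : ContinuousAt E s := hE.continuousAt (Ici_mem_nhds hs.1)
    have : HasDerivAt (fun t => (∫ s in (0 : ℝ)..t, E s) - R (U 0)) (E s) s := by
      refine HasDerivAt.sub_const _ (intervalIntegral.integral_hasDerivAt_right ?_ ?_ hc)
      · refine (hE.mono ?_).intervalIntegrable
        rw [uIcc_of_le hs.1.le]; exact Icc_subset_Ici_self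
      · exact (hE.mono Ioi_subset_Ici_self).stronglyMeasurableAtFilter isOpen_Ioi s hs.1
    refine this.congr_of_eventuallyEq ?_
    filter_upwards [Ioi_mem_nhds hs.1] with t ht
    exact hRE t (le_of_lt ht)
  obtain ⟨P, hP, hPd⟩ := hχ.hasDerivAt
  have hgi := hχ.intervalIntegrable hT
  have hi1 : IntervalIntegrable (fun s => χ s • E s) volume 0 T := by
    refine ContinuousOn.intervalIntegrable ?_
    rw [uIcc_of_le hT] at hE' ⊢
    exact hχ.continuousOn.smul hE'
  have hi2 : IntervalIntegrable (fun s => g s • E s) volume 0 T := hgi.smul_continuousOn hE'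
  have hi3 : IntervalIntegrable (fun s => g s • (-R (E s))) volume 0 T :=
    hgi.smul_continuousOn (by rwa [uIcc_of_le hT])
  -- Integration by parts: `-R (e^{-z s} U(s))` is a primitive of `e^{-z s} U(s)`.
  have key := MeasureTheory.integral_eq_of_hasDerivAt_off_countable_of_le
    (fun s => χ s • (-R (E s))) (fun s => χ s • E s + g s • (-R (E s))) hT hP
    (hχ.continuousOn.smul hcont) (fun s hs => (hPd s hs).smul (hder s hs.1)) (hi1.add hi3)
  rw [intervalIntegral.integral_add hi1 hi3, h0, h1, zero_smul, zero_smul, sub_zero] at key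
  rw [eq_neg_of_add_eq_zero_left key, ← intervalIntegral.integral_neg,
    ← R.intervalIntegral_comp_comm hi2]
  refine intervalIntegral.integral_congr fun s _ => ?_
  simp [ContinuousLinearMap.map_smul_of_tower]

theorem memLp_smul_exp_smul {H : Type*} [NormedAddCommGroup H] [InnerProductSpace ℂ H]
    {U : ℝ → H} (hU : ContinuousOn U (Ici 0)) {g : ℝ → ℝ} {T B : ℝ}
    (hg : AEStronglyMeasurable g (volume.restrict (Ioc 0 T))) (hB : ∀ s ∈ Icc 0 T, |g s| ≤ B)
    (ω : ℝ) : MemLp (fun s => g s • (Real.exp (-ω * s) • U s)) 2 (volume.restrict (Ioc 0 T)) := by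
  have hc : ContinuousOn (fun s => Real.exp (-ω * s) • U s) (Icc 0 T) :=
    (by fun_prop : Continuous fun s : ℝ => Real.exp (-ω * s)).continuousOn.smul
      (hU.mono Icc_subset_Ici_self)
  obtain ⟨C, hC⟩ := isCompact_Icc.exists_bound_of_continuousOn hc
  refine MemLp.of_bound (C := B * C) (hg.smul ((hc.mono Ioc_subset_Icc_self).aestronglyMeasurable
    measurableSet_Ioc)) ?_
  filter_upwards [ae_restrict_mem measurableSet_Ioc] with s hs
  have hs := Ioc_subset_Icc_self hs
  rw [norm_smul]
  exact mul_le_mul (hB s hs) (hC s hs) (norm_nonneg _) ((abs_nonneg _).trans (hB s hs))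

theorem lintegral_enorm_sq_eq_ofReal_integral {H : Type*} [NormedAddCommGroup H]
    [InnerProductSpace ℂ H] {U : ℝ → H} {g : ℝ → ℝ} {T ω : ℝ} (hT : 0 ≤ T)
    (hf : MemLp (fun s => g s • (Real.exp (-ω * s) • U s)) 2 (volume.restrict (Ioc 0 T))) :
    ∫⁻ s in Ioc 0 T, ‖g s • (Real.exp (-ω * s) • U s)‖ₑ ^ 2
      = ENNReal.ofReal (∫ s in (0 : ℝ)..T, g s ^ 2 * energyDensity U ω s) := by
  have h := hf.integrable_norm_pow (by norm_num)
  rw [intervalIntegral.integral_of_le hT]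
  have heq : ∀ s, g s ^ 2 * energyDensity U ω s = ‖g s • (Real.exp (-ω * s) • U s)‖ ^ 2 := by
    intro s
    rw [norm_smul, norm_smul, mul_pow, Real.norm_eq_abs, sq_abs, Real.norm_eq_abs, Real.abs_exp,
      energyDensity]
  simp_rw [heq]
  rw [ofReal_integral_eq_lintegral_ofReal h (ae_of_all _ fun s => by positivity)]
  simp [ENNReal.ofReal_pow]

/-- The energy inequality for weights that vanish at both ends: the resolvent estimate on the line
`Re z = ω`, transported to the orbit by Parseval's identity. -/
theorem integral_sq_mul_energyDensity_le {H : Type*} [NormedAddCommGroup H] [InnerProductSpace ℂ H]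
    [CompleteSpace H] {U : ℝ → H} (hU : ContinuousOn U (Ici 0)) {R : ℂ → H →L[ℂ] H}
    {K ω T : ℝ} (hT : 0 < T) (hRK : ∀ z : ℂ, z.re = ω → ‖R z‖ ≤ K)
    (hR : ∀ z : ℂ, z.re = ω → IsResolventOfOrbit (R z) z U) {χ g : ℝ → ℝ}
    (hχ : IsPrimitiveOn χ g 0 T) (h0 : χ 0 = 0) (h1 : χ T = 0) :
    ∫ s in (0 : ℝ)..T, χ s ^ 2 * energyDensity U ω s
      ≤ K ^ 2 * ∫ s in (0 : ℝ)..T, g s ^ 2 * energyDensity U ω s := by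
  obtain ⟨B, hB⟩ := hχ.bounded
  obtain ⟨B', hB'⟩ := isCompact_Icc.exists_bound_of_continuousOn hχ.continuousOn
  have hm1 := memLp_smul_exp_smul hU ((hχ.continuousOn.mono
    Ioc_subset_Icc_self).aestronglyMeasurable measurableSet_Ioc) hB' ω
  have hm2 := memLp_smul_exp_smul hU hχ.measurable.aestronglyMeasurable hB ω
  have hK : 0 ≤ K := (norm_nonneg _).trans (hRK ω (by simp))
  have hcoef : ∀ n : ℤ, ∃ z : ℂ, z.re = ω ∧ ∀ k : ℝ → ℝ,
      fourierCoeffOn hT (fun s => k s • (Real.exp (-ω * s) • U s)) n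
        = (1 / T) • ∫ s in (0 : ℝ)..T, k s • (Complex.exp (-z * s) • U s) := by
    intro n
    -- The `n`-th Fourier coefficient of `e^{-ω s} f(s)` on `[0, T]` is, up to the factor `1 / T`,
    -- the Laplace transform of `f` at `ω + 2πin/T`.
    refine ⟨ω + (2 * Real.pi * n / T : ℝ) * Complex.I, by simp, fun k => ?_⟩
    rw [fourierCoeffOn_eq_integral, sub_zero]
    congr 1
    refine intervalIntegral.integral_congr fun s _ => ?_
    simp only [fourier_coe_apply]
    rw [← Complex.coe_smul (Real.exp _), smul_comm, smul_smul, Complex.ofReal_exp,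
      ← Complex.exp_add]
    congr 3
    push_cast
    ring
  have hle : ∀ n : ℤ, ‖fourierCoeffOn hT (fun s => χ s • (Real.exp (-ω * s) • U s)) n‖ₑ ^ 2
      ≤ ENNReal.ofReal (K ^ 2) *
        ‖fourierCoeffOn hT (fun s => g s • (Real.exp (-ω * s) • U s)) n‖ₑ ^ 2 := by
    intro n
    obtain ⟨z, hz, hk⟩ := hcoef n
    rw [hk, hk, (hR z hz).integral_smul hU hT.le hχ h0 h1, ← ContinuousLinearMap.map_smul_of_tower,
      ENNReal.ofReal_pow hK, ← mul_pow]
    refine pow_le_pow_left₀ (zero_le) ?_ 2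
    rw [← ofReal_norm, ← ofReal_norm, ← ENNReal.ofReal_mul hK]
    exact ENNReal.ofReal_le_ofReal ((R z).le_of_opNorm_le (hRK z hz) _)
  have hsum := ENNReal.tsum_le_tsum hle
  have hTne : ENNReal.ofReal (T - 0)⁻¹ ≠ 0 := by simpa using hT
  rw [ENNReal.tsum_mul_left, tsum_enorm_fourierCoeffOn_sq hT hm1,
    tsum_enorm_fourierCoeffOn_sq hT hm2, mul_left_comm,
    ENNReal.mul_le_mul_iff_right hTne ENNReal.ofReal_ne_top,
    lintegral_enorm_sq_eq_ofReal_integral hT.le hm1,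
    lintegral_enorm_sq_eq_ofReal_integral hT.le hm2, ← ENNReal.ofReal_mul (by positivity)] at hsum
  refine (ENNReal.ofReal_le_ofReal_iff ?_).1 hsum
  refine mul_nonneg (by positivity) (intervalIntegral.integral_nonneg hT.le fun s _ => ?_)
  exact mul_nonneg (sq_nonneg _) (energyDensity_nonneg _ _ _)

/-! ### The energy inequality for general weights -/

theorem energyDensity_eq_exp_mul {H : Type*} [NormedAddCommGroup H] (U : ℝ → H) (ω ω' s : ℝ) :
    energyDensity U ω' s = Real.exp (2 * (ω - ω') * s) * energyDensity U ω s := by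
  have h : Real.exp (-ω' * s) ^ 2 = Real.exp (2 * (ω - ω') * s) * Real.exp (-ω * s) ^ 2 := by
    rw [← Real.exp_nat_mul, ← Real.exp_nat_mul, ← Real.exp_add]
    congr 1
    push_cast
    ring
  rw [energyDensity, energyDensity, mul_pow, mul_pow, h, mul_assoc]

theorem intervalIntegrable_energyDensity {H : Type*} [NormedAddCommGroup H] {U : ℝ → H}
    (hU : ContinuousOn U (Ici 0)) (ω : ℝ) {c d : ℝ} (hc : 0 ≤ c) (hd : 0 ≤ d) :
    IntervalIntegrable (energyDensity U ω) volume c d :=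
  ((continuousOn_energyDensity hU ω).mono fun _ hs =>
    (le_min hc hd).trans hs.1).intervalIntegrable

theorem IsPrimitiveOn.intervalIntegrable_mul_energyDensity {H : Type*} [NormedAddCommGroup H]
    {U : ℝ → H} (hU : ContinuousOn U (Ici 0)) (ω r : ℝ) {χ g : ℝ → ℝ} {T : ℝ} (hT : 0 ≤ T)
    (hχ : IsPrimitiveOn χ g 0 T) :
    IntervalIntegrable (fun s => (r ^ 2 * χ s ^ 2 - g s ^ 2) * energyDensity U ω s)
      volume 0 T := by
  refine IntervalIntegrable.mul_continuousOn (IntervalIntegrable.sub ?_ ?_) ?_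
  · refine ContinuousOn.intervalIntegrable ?_
    rw [uIcc_of_le hT]
    exact continuousOn_const.mul (hχ.continuousOn.pow 2)
  · exact hχ.intervalIntegrable_sq hT
  · rw [uIcc_of_le hT]
    exact (continuousOn_energyDensity hU ω).mono Icc_subset_Ici_self

theorem integral_le_zero_of_vanishing {H : Type*} [NormedAddCommGroup H] [InnerProductSpace ℂ H]
    [CompleteSpace H] {U : ℝ → H} (hU : ContinuousOn U (Ici 0)) {R : ℂ → H →L[ℂ] H}
    {r ω T : ℝ} (hr : 0 < r) (hT : 0 < T) (hRr : ∀ z : ℂ, z.re = ω → ‖R z‖ ≤ r⁻¹)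
    (hR : ∀ z : ℂ, z.re = ω → IsResolventOfOrbit (R z) z U) {χ g : ℝ → ℝ}
    (hχ : IsPrimitiveOn χ g 0 T) (h0 : χ 0 = 0) (h1 : χ T = 0) :
    ∫ s in (0 : ℝ)..T, (r ^ 2 * χ s ^ 2 - g s ^ 2) * energyDensity U ω s ≤ 0 := by
  have hE : ContinuousOn (energyDensity U ω) (uIcc 0 T) := by
    rw [uIcc_of_le hT.le]
    exact (continuousOn_energyDensity hU ω).mono Icc_subset_Ici_self
  have hi1 : IntervalIntegrable (fun s => χ s ^ 2 * energyDensity U ω s) volume 0 T := by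
    refine ContinuousOn.intervalIntegrable ?_
    rw [uIcc_of_le hT.le] at hE ⊢
    exact (hχ.continuousOn.pow 2).mul hE
  have hi2 : IntervalIntegrable (fun s => g s ^ 2 * energyDensity U ω s) volume 0 T :=
    (hχ.intervalIntegrable_sq hT.le).mul_continuousOn hE
  have h := integral_sq_mul_energyDensity_le hU hT hRr hR hχ h0 h1
  simp_rw [sub_mul, mul_assoc]
  rw [intervalIntegral.integral_sub (hi1.const_mul _) hi2, intervalIntegral.integral_const_mul]
  have h3 : r ^ 2 * (r⁻¹ ^ 2) = 1 := by field_simp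
  have h4 := mul_le_mul_of_nonneg_left h (sq_nonneg r)
  rw [← mul_assoc, h3, one_mul] at h4
  linarith

theorem exp_le_four_mul_sinh {x : ℝ} (hx : 1 ≤ x) : Real.exp x ≤ 4 * Real.sinh x := by
  rw [Real.sinh_eq]
  have h1 := Real.add_one_le_exp x
  have h2 : Real.exp (-x) ≤ 1 := Real.exp_le_one_iff.2 (by linarith)
  linarith

/-- The energy inequality for weights with arbitrary value at `T`, provided that the orbit is square
integrable for a weight exponent which exceeds `ω` by at most `r / 2`. -/
theorem integral_le_zero_of_energy_bound {H : Type*} [NormedAddCommGroup H]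
    [InnerProductSpace ℂ H] [CompleteSpace H] {U : ℝ → H} (hU : ContinuousOn U (Ici 0))
    {R : ℂ → H →L[ℂ] H} {r ω ω₁ T C : ℝ} (hr : 0 < r) (hT : 0 ≤ T)
    (hRr : ∀ z : ℂ, z.re = ω → ‖R z‖ ≤ r⁻¹)
    (hR : ∀ z : ℂ, z.re = ω → IsResolventOfOrbit (R z) z U)
    (hω : ω₁ ≤ ω + r / 2) (hC : ∀ N, 0 ≤ N → ∫ s in (0 : ℝ)..N, energyDensity U ω₁ s ≤ C)
    {χ g : ℝ → ℝ} (hχ : IsPrimitiveOn χ g 0 T) (h0 : χ 0 = 0) :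
    ∫ s in (0 : ℝ)..T, (r ^ 2 * χ s ^ 2 - g s ^ 2) * energyDensity U ω s ≤ 0 := by
  have hC0 : 0 ≤ C := by simpa using hC 0 le_rfl
  have hlim : Tendsto (fun N : ℝ => 16 * (χ T * r) ^ 2 * C * Real.exp (2 * (r * T)) *
      Real.exp (-(r * N))) atTop (𝓝 0) := by
    have : Tendsto (fun N : ℝ => Real.exp (-(r * N))) atTop (𝓝 0) :=
      Real.tendsto_exp_neg_atTop_nhds_zero.comp (tendsto_id.const_mul_atTop hr)
    simpa using this.const_mul (16 * (χ T * r) ^ 2 * C * Real.exp (2 * (r * T)))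
  refine ge_of_tendsto hlim ?_
  filter_upwards [eventually_ge_atTop (T + 1 / r)] with N hN
  have hrN : 1 ≤ r * (N - T) := by
    have : 1 / r ≤ N - T := by linarith
    rwa [div_le_iff₀ hr, mul_comm] at this
  have hTN : T < N := lt_of_lt_of_le (by linarith [one_div_pos.2 hr]) hN
  have hN0 : 0 < N := hT.trans_lt hTN
  set σ := Real.sinh (r * (N - T)) with hσ
  have hexp := exp_le_four_mul_sinh hrN
  have hσ0 : 0 < σ := by linarith [Real.exp_pos (r * (N - T))]
  -- The continuation of `χ` to `[T, N]`, for which `r² χ₂² - χ₂'²` is a small negative constant.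
  set χ₂ : ℝ → ℝ := fun s => χ T / σ * Real.sinh (r * (N - s))
  set g₂ : ℝ → ℝ := fun s => χ T / σ * (Real.cosh (r * (N - s)) * -r)
  have hχ₂ : IsPrimitiveOn χ₂ g₂ T N := by
    refine IsPrimitiveOn.of_hasDerivAt (fun s => ?_) (by fun_prop) T N
    have h1 : HasDerivAt (fun s : ℝ => r * (N - s)) (-r) s := by
      simpa using ((hasDerivAt_id s).const_sub N).const_mul r
    exact h1.sinh.const_mul _
  have heq : χ T = χ₂ T := by simp only [χ₂]; rw [← hσ]; field_simp
  have hglue := hχ.glue hχ₂ hT hTN.le heq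
  have hT0 : (fun s => if s ≤ T then χ s else χ₂ s) 0 = 0 := by simp [hT, h0]
  have hTN0 : (fun s => if s ≤ T then χ s else χ₂ s) N = 0 := by simp [not_le.2 hTN, χ₂]
  have key := integral_le_zero_of_vanishing hU hr hN0 hRr hR hglue hT0 hTN0
  have hint := hglue.intervalIntegrable_mul_energyDensity hU ω r hN0.le
  have hsub1 : uIcc 0 T ⊆ uIcc 0 N := by
    rw [uIcc_of_le hT, uIcc_of_le hN0.le]; exact Icc_subset_Icc_right hTN.le
  have hsub2 : uIcc T N ⊆ uIcc 0 N := by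
    rw [uIcc_of_le hTN.le, uIcc_of_le hN0.le]; exact Icc_subset_Icc_left hT
  rw [← intervalIntegral.integral_add_adjacent_intervals (hint.mono_set hsub1)
    (hint.mono_set hsub2)] at key
  have e1 : ∫ s in (0 : ℝ)..T, (r ^ 2 * (if s ≤ T then χ s else χ₂ s) ^ 2 -
      (if s ≤ T then g s else g₂ s) ^ 2) * energyDensity U ω s
      = ∫ s in (0 : ℝ)..T, (r ^ 2 * χ s ^ 2 - g s ^ 2) * energyDensity U ω s := by
    refine intervalIntegral.integral_congr fun s hs => ?_
    rw [uIcc_of_le hT] at hs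
    simp [hs.2]
  have e2 : ∫ s in T..N, (r ^ 2 * (if s ≤ T then χ s else χ₂ s) ^ 2 -
      (if s ≤ T then g s else g₂ s) ^ 2) * energyDensity U ω s
      = ∫ s in T..N, -(χ T * r / σ) ^ 2 * energyDensity U ω s := by
    refine intervalIntegral.integral_congr_Ioo_of_le hTN.le fun s hs => ?_
    simp only [not_le.2 hs.1, if_false, χ₂, g₂]
    congr 1
    have := Real.cosh_sq (r * (N - s))
    field_simp
    rw [this]
    ring
  rw [e1, e2, intervalIntegral.integral_const_mul] at key
  have hTN_le : ∫ s in T..N, energyDensity U ω s ≤ Real.exp (r * N) * C := by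
    calc ∫ s in T..N, energyDensity U ω s ≤ ∫ s in (0 : ℝ)..N, energyDensity U ω s := by
          refine intervalIntegral.integral_mono_interval hT hTN.le le_rfl
            (ae_of_all _ fun s => energyDensity_nonneg U ω s)
            (intervalIntegrable_energyDensity hU ω le_rfl hN0.le)
      _ ≤ ∫ s in (0 : ℝ)..N, Real.exp (r * N) * energyDensity U ω₁ s := by
          refine intervalIntegral.integral_mono_on hN0.le
            (intervalIntegrable_energyDensity hU ω le_rfl hN0.le)
            ((intervalIntegrable_energyDensity hU ω₁ le_rfl hN0.le).const_mul _) fun s hs => ?_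
          rw [energyDensity_eq_exp_mul U ω₁ ω]
          refine mul_le_mul_of_nonneg_right (Real.exp_le_exp.2 ?_) (energyDensity_nonneg _ _ _)
          exact mul_le_mul (by linarith) hs.2 hs.1 hr.le
      _ ≤ Real.exp (r * N) * C := by
          rw [intervalIntegral.integral_const_mul]
          exact mul_le_mul_of_nonneg_left (hC N hN0.le) (Real.exp_pos _).le
  have hσ2 : 1 / σ ^ 2 ≤ 16 * Real.exp (-(2 * (r * (N - T)))) := by
    rw [Real.exp_neg, div_le_iff₀ (by positivity), two_mul, Real.exp_add]
    have := Real.exp_pos (r * (N - T))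
    field_simp
    nlinarith
  calc ∫ s in (0 : ℝ)..T, (r ^ 2 * χ s ^ 2 - g s ^ 2) * energyDensity U ω s
      ≤ (χ T * r) ^ 2 * (1 / σ ^ 2) * ∫ s in T..N, energyDensity U ω s := by
        have : (χ T * r / σ) ^ 2 = (χ T * r) ^ 2 * (1 / σ ^ 2) := by field_simp
        rw [← this]
        linarith
    _ ≤ (χ T * r) ^ 2 * (16 * Real.exp (-(2 * (r * (N - T))))) * (Real.exp (r * N) * C) := by
        refine mul_le_mul (mul_le_mul_of_nonneg_left hσ2 (sq_nonneg _)) hTN_le ?_ (by positivity)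
        exact intervalIntegral.integral_nonneg hTN.le fun s _ => energyDensity_nonneg _ _ _
    _ = 16 * (χ T * r) ^ 2 * C * Real.exp (2 * (r * T)) * Real.exp (-(r * N)) := by
        have : Real.exp (-(2 * (r * (N - T)))) * Real.exp (r * N)
            = Real.exp (2 * (r * T)) * Real.exp (-(r * N)) := by
          rw [← Real.exp_add, ← Real.exp_add]; congr 1; ring
        linear_combination 16 * (χ T * r) ^ 2 * C * this

/-- Square integrability of an orbit improves by `r / 2` in the weight exponent. -/
theorem exists_energy_bound_of_shifted {H : Type*} [NormedAddCommGroup H]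
    [InnerProductSpace ℂ H] [CompleteSpace H] {U : ℝ → H} (hU : ContinuousOn U (Ici 0))
    {R : ℂ → H →L[ℂ] H} {r ω : ℝ} (hr : 0 < r)
    (hRr : ∀ z : ℂ, z.re = ω → ‖R z‖ ≤ r⁻¹)
    (hR : ∀ z : ℂ, z.re = ω → IsResolventOfOrbit (R z) z U)
    (h : ∃ C, ∀ N, 0 ≤ N → ∫ s in (0 : ℝ)..N, energyDensity U (ω + r / 2) s ≤ C) :
    ∃ C, ∀ N, 0 ≤ N → ∫ s in (0 : ℝ)..N, energyDensity U ω s ≤ C := by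
  obtain ⟨C, hC⟩ := h
  set L := 2 / r
  have hL : 0 < L := by positivity
  have hEi : ∀ {c d : ℝ}, 0 ≤ c → 0 ≤ d → IntervalIntegrable (energyDensity U ω) volume c d :=
    fun hc hd => intervalIntegrable_energyDensity hU ω hc hd
  have hL0 : 0 ≤ ∫ s in (0 : ℝ)..L, energyDensity U ω s :=
    intervalIntegral.integral_nonneg hL.le fun s _ => energyDensity_nonneg _ _ _
  refine ⟨2 * ∫ s in (0 : ℝ)..L, energyDensity U ω s, fun N hN => ?_⟩
  rcases le_total N L with hNL | hNL
  · have : ∫ s in (0 : ℝ)..N, energyDensity U ω s ≤ ∫ s in (0 : ℝ)..L, energyDensity U ω s :=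
      intervalIntegral.integral_mono_interval le_rfl hN hNL
        (ae_of_all _ fun s => energyDensity_nonneg U ω s) (hEi le_rfl hL.le)
    linarith
  -- The weight `χ(s) = s` gives `r² χ² - χ'² = r² s² - 1`, which is at least `-1` everywhere and at
  -- least `1` for `s ≥ 2 / r`.
  · have hχ : IsPrimitiveOn (fun s => s) (fun _ => 1) 0 N :=
      IsPrimitiveOn.of_hasDerivAt (fun s => hasDerivAt_id s) continuous_const 0 N
    have key := integral_le_zero_of_energy_bound hU hr hN hRr hR le_rfl hC hχ rfl
    have hint := hχ.intervalIntegrable_mul_energyDensity hU ω r hN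
    have hsub1 : uIcc 0 L ⊆ uIcc 0 N := by
      rw [uIcc_of_le hL.le, uIcc_of_le hN]; exact Icc_subset_Icc_right hNL
    have hsub2 : uIcc L N ⊆ uIcc 0 N := by
      rw [uIcc_of_le hNL, uIcc_of_le hN]; exact Icc_subset_Icc_left hL.le
    have hi1 := hint.mono_set hsub1
    have hi2 := hint.mono_set hsub2
    rw [← intervalIntegral.integral_add_adjacent_intervals hi1 hi2] at key
    have h1 : ∫ s in (0 : ℝ)..L, -energyDensity U ω s
        ≤ ∫ s in (0 : ℝ)..L, (r ^ 2 * s ^ 2 - 1 ^ 2) * energyDensity U ω s := by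
      refine intervalIntegral.integral_mono_on hL.le (hEi le_rfl hL.le).neg hi1 fun s _ => ?_
      nlinarith [mul_nonneg (sq_nonneg (r * s)) (energyDensity_nonneg U ω s)]
    have h2 : ∫ s in L..N, energyDensity U ω s
        ≤ ∫ s in L..N, (r ^ 2 * s ^ 2 - 1 ^ 2) * energyDensity U ω s := by
      refine intervalIntegral.integral_mono_on hNL (hEi hL.le hN) hi2 fun s hs => ?_
      refine le_mul_of_one_le_left (energyDensity_nonneg U ω s) ?_
      have : 2 ≤ r * s := by
        have h := mul_le_mul_of_nonneg_left hs.1 hr.le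
        rwa [mul_div_cancel₀ _ hr.ne'] at h
      nlinarith
    rw [intervalIntegral.integral_neg] at h1
    rw [← intervalIntegral.integral_add_adjacent_intervals (hEi le_rfl hL.le) (hEi hL.le hN)]
    linarith

theorem exists_energy_bound_of_norm_le {H : Type*} [NormedAddCommGroup H] {U : ℝ → H}
    (hU : ContinuousOn U (Ici 0)) {M ω₀ ω : ℝ}
    (hM : ∀ s, 0 ≤ s → ‖U s‖ ≤ M * Real.exp (ω₀ * s)) (hω : ω₀ + 1 ≤ ω) :
    ∃ C, ∀ N, 0 ≤ N → ∫ s in (0 : ℝ)..N, energyDensity U ω s ≤ C := by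
  refine ⟨M ^ 2, fun N hN => ?_⟩
  have hd : ∀ s : ℝ, HasDerivAt (fun s => -(M ^ 2 * Real.exp (-s))) (M ^ 2 * Real.exp (-s)) s := by
    intro s
    simpa using ((hasDerivAt_id s).fun_neg.exp.const_mul (M ^ 2)).fun_neg
  have hci : IntervalIntegrable (fun s => M ^ 2 * Real.exp (-s)) volume 0 N :=
    (by fun_prop : Continuous fun s : ℝ => M ^ 2 * Real.exp (-s)).intervalIntegrable _ _
  calc ∫ s in (0 : ℝ)..N, energyDensity U ω s ≤ ∫ s in (0 : ℝ)..N, M ^ 2 * Real.exp (-s) := by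
        refine intervalIntegral.integral_mono_on hN
          (intervalIntegrable_energyDensity hU ω le_rfl hN) hci fun s hs => ?_
        have h1 : Real.exp (-ω * s) * ‖U s‖ ≤ M * Real.exp (ω₀ * s - ω * s) := by
          calc Real.exp (-ω * s) * ‖U s‖ ≤ Real.exp (-ω * s) * (M * Real.exp (ω₀ * s)) :=
                mul_le_mul_of_nonneg_left (hM s hs.1) (Real.exp_pos _).le
            _ = M * (Real.exp (ω₀ * s) * Real.exp (-ω * s)) := by ring
            _ = M * Real.exp (ω₀ * s - ω * s) := by rw [← Real.exp_add]; congr 2; ring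
        calc energyDensity U ω s ≤ (M * Real.exp (ω₀ * s - ω * s)) ^ 2 :=
              pow_le_pow_left₀ (by positivity) h1 2
          _ = M ^ 2 * Real.exp (2 * (ω₀ * s - ω * s)) := by
              rw [mul_pow, ← Real.exp_nat_mul]; norm_num
          _ ≤ M ^ 2 * Real.exp (-s) := by
              refine mul_le_mul_of_nonneg_left (Real.exp_le_exp.2 ?_) (sq_nonneg _)
              nlinarith [hs.1, mul_nonneg hs.1 (sub_nonneg.2 hω)]
    _ = M ^ 2 - M ^ 2 * Real.exp (-N) := by
        rw [intervalIntegral.integral_eq_sub_of_hasDerivAt (fun s _ => hd s) hci]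
        simp only [neg_zero, Real.exp_zero]
        ring
    _ ≤ M ^ 2 := by linarith [mul_nonneg (sq_nonneg M) (Real.exp_pos (-N)).le]

/-- Exponentially bounded orbits are square integrable with respect to the weight `e^{-ω ·}` if the
resolvent is bounded by `1 / r` on the half-plane `Re z ≥ ω`: a quantitative form of the
Gearhart–Prüss theorem. -/
theorem exists_energy_bound {H : Type*} [NormedAddCommGroup H]
    [InnerProductSpace ℂ H] [CompleteSpace H] {U : ℝ → H} (hU : ContinuousOn U (Ici 0))
    {R : ℂ → H →L[ℂ] H} {r ω M ω₀ : ℝ} (hr : 0 < r)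
    (hRr : ∀ z : ℂ, ω ≤ z.re → ‖R z‖ ≤ r⁻¹)
    (hR : ∀ z : ℂ, ω ≤ z.re → IsResolventOfOrbit (R z) z U)
    (hM : ∀ s, 0 ≤ s → ‖U s‖ ≤ M * Real.exp (ω₀ * s)) :
    ∃ C, ∀ N, 0 ≤ N → ∫ s in (0 : ℝ)..N, energyDensity U ω s ≤ C := by
  have step : ∀ n : ℕ, (∃ C, ∀ N, 0 ≤ N →
      ∫ s in (0 : ℝ)..N, energyDensity U (ω + n * (r / 2)) s ≤ C) →
      ∃ C, ∀ N, 0 ≤ N → ∫ s in (0 : ℝ)..N, energyDensity U ω s ≤ C := by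
    intro n
    induction n with
    | zero => simp
    | succ n ih =>
      intro h
      have hle : ω ≤ ω + n * (r / 2) := le_add_of_nonneg_right (by positivity)
      refine ih (exists_energy_bound_of_shifted hU hr (fun z hz => hRr z (hle.trans hz.ge))
        (fun z hz => hR z (hle.trans hz.ge)) ?_)
      have heq : ω + n * (r / 2) + r / 2 = ω + (n + 1 : ℕ) * (r / 2) := by
        push_cast
        ring
      rwa [heq]
  obtain ⟨n, hn⟩ := exists_nat_gt ((ω₀ + 1 - ω) / (r / 2))
  refine step n (exists_energy_bound_of_norm_le hU hM ?_)
  rw [div_lt_iff₀ (by positivity)] at hn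
  linarith

/-- The energy inequality: `∫_0^T (r² χ² - χ'²) E_ω ≤ 0` for every weight with `χ(0) = 0`. -/
theorem integral_weight_mul_energyDensity_nonpos {H : Type*} [NormedAddCommGroup H]
    [InnerProductSpace ℂ H] [CompleteSpace H] {U : ℝ → H} (hU : ContinuousOn U (Ici 0))
    {R : ℂ → H →L[ℂ] H} {r ω M ω₀ T : ℝ} (hr : 0 < r)
    (hRr : ∀ z : ℂ, ω < z.re → ‖R z‖ ≤ r⁻¹)
    (hR : ∀ z : ℂ, ω < z.re → IsResolventOfOrbit (R z) z U)
    (hM : ∀ s, 0 ≤ s → ‖U s‖ ≤ M * Real.exp (ω₀ * s)) (hT : 0 ≤ T)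
    {χ g : ℝ → ℝ} (hχ : IsPrimitiveOn χ g 0 T) (h0 : χ 0 = 0) :
    ∫ s in (0 : ℝ)..T, (r ^ 2 * χ s ^ 2 - g s ^ 2) * energyDensity U ω s ≤ 0 := by
  have hint := fun ω' => hχ.intervalIntegrable_mul_energyDensity hU ω' r hT
  have hlim : Tendsto
      (fun ω' => ∫ s in (0 : ℝ)..T, (r ^ 2 * χ s ^ 2 - g s ^ 2) * energyDensity U ω' s)
      (𝓝[>] ω) (𝓝 (∫ s in (0 : ℝ)..T, (r ^ 2 * χ s ^ 2 - g s ^ 2) * energyDensity U ω s)) := by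
    refine intervalIntegral.tendsto_integral_filter_of_dominated_convergence
      (fun s => ‖(r ^ 2 * χ s ^ 2 - g s ^ 2) * energyDensity U ω s‖) ?_ ?_ (hint ω).norm ?_
    · exact Eventually.of_forall fun ω' => by
        rw [uIoc_of_le hT]
        exact (hint ω').1.aestronglyMeasurable
    · filter_upwards [self_mem_nhdsWithin] with ω' hω'
      refine ae_of_all _ fun s hs => ?_
      rw [uIoc_of_le hT] at hs
      rw [norm_mul, norm_mul]
      refine mul_le_mul_of_nonneg_left ?_ (norm_nonneg _)
      rw [Real.norm_of_nonneg (energyDensity_nonneg _ _ _),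
        Real.norm_of_nonneg (energyDensity_nonneg _ _ _), energyDensity_eq_exp_mul U ω ω']
      refine mul_le_of_le_one_left (energyDensity_nonneg _ _ _) (Real.exp_le_one_iff.2 ?_)
      have := mem_Ioi.1 hω'
      exact mul_nonpos_of_nonpos_of_nonneg (by linarith) hs.1.le
    · refine ae_of_all _ fun s _ => Tendsto.mono_left ?_ nhdsWithin_le_nhds
      refine Continuous.tendsto ?_ ω
      unfold energyDensity
      fun_prop
  -- The resolvent is only known to be bounded by `1 / r` for `Re z > ω`, so the inequality is
  -- proved for the exponents `ω' > ω` first.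
  refine le_of_tendsto hlim ?_
  filter_upwards [self_mem_nhdsWithin] with ω' hω'
  obtain ⟨C, hC⟩ := exists_energy_bound hU hr (fun z hz => hRr z (lt_of_lt_of_le hω' hz))
    (fun z hz => hR z (lt_of_lt_of_le hω' hz)) hM
  exact integral_le_zero_of_energy_bound hU hr hT (fun z hz => hRr z (by rw [hz]; exact hω'))
    (fun z hz => hR z (by rw [hz]; exact hω')) (by linarith) hC hχ h0

/-! ### Orbits of a semigroup and of its adjoint -/

namespace StronglyContinuousSemigroup

variable {H : Type*} [NormedAddCommGroup H] [InnerProductSpace ℂ H]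

theorem exists_norm_le_exp (S : StronglyContinuousSemigroup H) {m : ℝ → ℝ}
    (hm : ContinuousOn m (Ici 0)) (hS : ∀ t, 0 ≤ t → ‖S.toFun t‖ ≤ m t) :
    ∃ M ω₀ : ℝ, ∀ t, 0 ≤ t → ‖S.toFun t‖ ≤ M * Real.exp (ω₀ * t) := by
  obtain ⟨B, hB⟩ := isCompact_Icc.exists_bound_of_continuousOn
    (hm.mono (Icc_subset_Ici_self : Icc (0 : ℝ) 1 ⊆ Ici 0))
  set M := max B 1
  have hM1 : 1 ≤ M := le_max_right _ _
  have hM : ∀ t ∈ Icc (0 : ℝ) 1, ‖S.toFun t‖ ≤ M := fun t ht =>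
    (hS t ht.1).trans ((le_abs_self _).trans ((hB t ht).trans (le_max_left _ _)))
  have hpow : ∀ n : ℕ, ∀ t : ℝ, 0 ≤ t → t ≤ n + 1 → ‖S.toFun t‖ ≤ M ^ (n + 1) := by
    intro n
    induction n with
    | zero => intro t h0 h1; simpa using hM t ⟨h0, by simpa using h1⟩
    | succ n ih =>
      intro t h0 h1
      push_cast at h1
      by_cases ht : t ≤ n + 1
      · exact (ih t h0 ht).trans (pow_le_pow_right₀ hM1 (Nat.le_succ _))
      · have hn : (0 : ℝ) ≤ n := n.cast_nonneg
        have h2 := S.map_add (t - 1) 1 (by linarith) zero_le_one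
        rw [sub_add_cancel] at h2
        rw [h2, pow_succ]
        exact (ContinuousLinearMap.opNorm_comp_le _ _).trans (mul_le_mul
          (ih (t - 1) (by linarith) (by linarith)) (hM 1 ⟨zero_le_one, le_rfl⟩) (norm_nonneg _)
          (by positivity))
  refine ⟨M, Real.log M, fun t ht => ?_⟩
  refine (hpow ⌊t⌋₊ t ht (Nat.lt_floor_add_one t).le).trans ?_
  rw [pow_succ']
  refine mul_le_mul_of_nonneg_left ?_ (by linarith)
  calc M ^ ⌊t⌋₊ = Real.exp (Real.log M * ⌊t⌋₊) := by
        rw [mul_comm, Real.exp_nat_mul, Real.exp_log (by linarith)]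
    _ ≤ Real.exp (Real.log M * t) := Real.exp_le_exp.2
        (mul_le_mul_of_nonneg_left (Nat.floor_le ht) (Real.log_nonneg hM1))

theorem hasGeneratorValue_generator (S : StronglyContinuousSemigroup H) (x : S.generator.domain) :
    S.HasGeneratorValue x (S.generator x) :=
  Classical.choose_spec x.2

theorem HasGeneratorValue.exists_generator_eq {S : StronglyContinuousSemigroup H} {x y : H}
    (h : S.HasGeneratorValue x y) : ∃ hx : x ∈ S.generator.domain, S.generator ⟨x, hx⟩ = y :=
  ⟨⟨y, h⟩, (S.hasGeneratorValue_generator _).unique h⟩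

theorem HasGeneratorValue.toFun_apply {S : StronglyContinuousSemigroup H} {x y : H}
    (h : S.HasGeneratorValue x y) {t : ℝ} (ht : 0 ≤ t) :
    S.HasGeneratorValue (S.toFun t x) (S.toFun t y) := by
  refine (((S.toFun t).continuous.tendsto y).comp h).congr' ?_
  filter_upwards [self_mem_nhdsWithin] with s hs
  have hs : 0 ≤ s := (mem_Ioi.1 hs).le
  simp only [Function.comp_apply, map_smul, map_sub]
  rw [← ContinuousLinearMap.comp_apply, ← S.map_add t s ht hs, add_comm, S.map_add s t hs ht,
    ContinuousLinearMap.comp_apply]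

theorem HasGeneratorValue.hasDerivWithinAt {S : StronglyContinuousSemigroup H} {x y : H}
    (h : S.HasGeneratorValue x y) {t : ℝ} (ht : 0 ≤ t) :
    HasDerivWithinAt (fun s => S.toFun s x) (S.toFun t y) (Ioi t) t := by
  rw [hasDerivWithinAt_iff_tendsto_slope' (by simp)]
  have hsub : Tendsto (fun u : ℝ => u - t) (𝓝[>] t) (𝓝[>] 0) := by
    refine tendsto_nhdsWithin_iff.2 ⟨?_, ?_⟩
    · have : Tendsto (fun u : ℝ => u - t) (𝓝 t) (𝓝 (t - t)) :=
        (continuous_id.sub continuous_const).tendsto t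
      rw [sub_self] at this
      exact this.mono_left nhdsWithin_le_nhds
    · filter_upwards [self_mem_nhdsWithin] with u hu
      exact sub_pos.2 (mem_Ioi.1 hu)
  refine ((h.toFun_apply ht).comp hsub).congr' ?_
  filter_upwards [self_mem_nhdsWithin] with u hu
  have hu : 0 ≤ u - t := (sub_pos.2 (mem_Ioi.1 hu)).le
  have h2 := S.map_add (u - t) t hu ht
  rw [sub_add_cancel] at h2
  rw [slope_def_module, h2]
  simp only [Function.comp_apply, ContinuousLinearMap.comp_apply]
  rw [← Complex.ofReal_inv, Complex.coe_smul]

end StronglyContinuousSemigroup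

namespace IsResolventAt

variable {H : Type*} [NormedAddCommGroup H] [InnerProductSpace ℂ H]
  {S : StronglyContinuousSemigroup H} {z : ℂ} {R : H →L[ℂ] H}

theorem hasGeneratorValue (hR : IsResolventAt S.generator z R) (x : H) :
    S.HasGeneratorValue (R x) (z • R x - x) := by
  obtain ⟨hx, h⟩ := hR.1 x
  have := S.hasGeneratorValue_generator ⟨R x, hx⟩
  rwa [show S.generator ⟨R x, hx⟩ = z • R x - x from
    (sub_eq_of_eq_add' (sub_eq_iff_eq_add.1 h)).symm] at this

theorem injective (hR : IsResolventAt S.generator z R) : Function.Injective R := by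
  intro x y hxy
  have h1 := hR.hasGeneratorValue x
  rw [hxy] at h1
  simpa using h1.unique (hR.hasGeneratorValue y)

theorem apply_toFun (hR : IsResolventAt S.generator z R) {t : ℝ} (ht : 0 ≤ t) (x : H) :
    R (S.toFun t x) = S.toFun t (R x) := by
  obtain ⟨hx, h⟩ := ((hR.hasGeneratorValue x).toFun_apply ht).exists_generator_eq
  have h2 := hR.2 ⟨_, hx⟩
  rw [h] at h2
  simpa using h2

theorem isResolventOfOrbit [CompleteSpace H] (hR : IsResolventAt S.generator z R) (x : H) :
    IsResolventOfOrbit R z (fun t => S.toFun t x) := by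
  intro t ht
  have hE := fun x => continuousOn_exp_smul (S.continuousOn x) z
  have hd : ∀ s ∈ Ioo (min 0 t) (max 0 t),
      HasDerivWithinAt (fun s : ℝ => -(Complex.exp (-z * s) • S.toFun s (R x)))
        (Complex.exp (-z * s) • S.toFun s x) (Ioi s) s := by
    intro s hs
    rw [min_eq_left ht] at hs
    have h1 : HasDerivWithinAt (fun s : ℝ => Complex.exp (-z * s))
        (Complex.exp (-z * s) * (-z)) (Ioi s) s := by
      have := (((hasDerivAt_id s).ofReal_comp).const_mul (-z)).cexp
      simpa using this.hasDerivWithinAt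
    convert! (h1.smul ((hR.hasGeneratorValue x).hasDerivWithinAt hs.1.le)).fun_neg using 1
    simp only [map_sub, map_smul, smul_sub, smul_smul]
    module
  have := intervalIntegral.integral_eq_sub_of_hasDeriv_right (a := 0) (b := t)
    ((hE (R x)).mono (by rw [uIcc_of_le ht]; exact Icc_subset_Ici_self)).neg hd
    ((hE x).mono (by rw [uIcc_of_le ht]; exact Icc_subset_Ici_self)).intervalIntegrable
  rw [this, map_sub, map_smul, hR.apply_toFun ht, hR.apply_toFun le_rfl]
  simp only [Pi.neg_apply, Complex.ofReal_zero, mul_zero, Complex.exp_zero, one_smul]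
  abel

theorem isResolventOfOrbit_adjoint [CompleteSpace H] (hR : IsResolventAt S.generator z R) {y : H}
    (hy : ContinuousOn (fun t => adjoint (S.toFun t) y) (Ici 0)) :
    IsResolventOfOrbit (adjoint R) (starRingEnd ℂ z) (fun t => adjoint (S.toFun t) y) := by
  intro t ht
  refine ext_inner_right ℂ fun x => ?_
  have hi : ∀ {f : ℝ → H}, ContinuousOn f (Ici 0) → IntervalIntegrable f volume 0 t := fun hf =>
    (hf.mono (by rw [uIcc_of_le ht]; exact Icc_subset_Ici_self)).intervalIntegrable
  have h1 := (innerSL ℂ x).intervalIntegral_comp_comm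
    (hi (continuousOn_exp_smul hy (starRingEnd ℂ z)))
  have h2 := (innerSL ℂ y).intervalIntegral_comp_comm
    (hi (continuousOn_exp_smul (S.continuousOn x) z))
  rw [hR.isResolventOfOrbit x t ht] at h2
  simp only [innerSL_apply_apply] at h1 h2
  rw [ContinuousLinearMap.adjoint_inner_left, ← inner_conj_symm, ← h1,
    ← intervalIntegral.intervalIntegral_conj]
  have h3 : ∀ s : ℝ, starRingEnd ℂ (inner ℂ x
      (Complex.exp (-(starRingEnd ℂ) z * s) • adjoint (S.toFun s) y))
      = inner ℂ y (Complex.exp (-z * s) • S.toFun s x) := by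
    intro s
    rw [inner_conj_symm, inner_smul_left, inner_smul_right, ContinuousLinearMap.adjoint_inner_left,
      ← Complex.exp_conj]
    simp
  simp_rw [h3]
  rw [h2, map_sub, map_smul, hR.apply_toFun ht, hR.apply_toFun le_rfl, inner_sub_left,
    inner_sub_right, inner_smul_left, inner_smul_right, ContinuousLinearMap.adjoint_inner_left,
    ContinuousLinearMap.adjoint_inner_left, ← Complex.exp_conj]
  simp

/-- The orbits of the adjoint semigroup that start in the range of `R*` are continuous, because
`t ↦ e^{-z t} R S(t)` is locally Lipschitz in operator norm. -/
theorem continuousOn_adjoint [CompleteSpace H] (hR : IsResolventAt S.generator z R) {m : ℝ → ℝ}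
    (hm : ContinuousOn m (Ici 0)) (hS : ∀ t, 0 ≤ t → ‖S.toFun t‖ ≤ m t) (y : H) :
    ContinuousOn (fun t => adjoint (S.toFun t) (adjoint R y)) (Ici 0) := by
  set B : ℝ → H →L[ℂ] H := fun t => Complex.exp (-z * t) • R.comp (S.toFun t)
  have hlip : ∀ N : ℝ, ContinuousOn B (Icc 0 N) := by
    intro N
    have hc : ContinuousOn (fun s : ℝ => ‖Complex.exp (-z * s)‖ * m s) (Icc 0 N) :=
      (by fun_prop : Continuous fun s : ℝ => ‖Complex.exp (-z * s)‖).continuousOn.mul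
        (hm.mono Icc_subset_Ici_self)
    obtain ⟨C, hC⟩ := isCompact_Icc.exists_bound_of_continuousOn hc
    refine (LipschitzOnWith.of_dist_le_mul (K := C.toNNReal) fun s hs t ht => ?_).continuousOn
    have hC0 : 0 ≤ C := (norm_nonneg _).trans (hC s hs)
    rw [dist_eq_norm, dist_eq_norm, Real.coe_toNNReal _ hC0]
    refine ContinuousLinearMap.opNorm_le_bound _ (by positivity) fun x => ?_
    have hB : ∀ s, 0 ≤ s → B s x = R (S.toFun 0 x) -
        ∫ u in (0 : ℝ)..s, Complex.exp (-z * u) • S.toFun u x := by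
      intro s hs
      rw [hR.isResolventOfOrbit x s hs, map_sub, map_smul]
      simp [B]
    have hi : ∀ {s : ℝ}, 0 ≤ s →
        IntervalIntegrable (fun u : ℝ => Complex.exp (-z * u) • S.toFun u x) volume 0 s :=
      fun hs => ((continuousOn_exp_smul (S.continuousOn x) z).mono
        (by rw [uIcc_of_le hs]; exact Icc_subset_Ici_self)).intervalIntegrable
    have hBst : (B s - B t) x = (∫ u in (0 : ℝ)..t, Complex.exp (-z * u) • S.toFun u x) -
        ∫ u in (0 : ℝ)..s, Complex.exp (-z * u) • S.toFun u x := by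
      rw [sub_apply, hB s hs.1, hB t ht.1]
      abel
    rw [hBst, intervalIntegral.integral_interval_sub_left (hi ht.1) (hi hs.1), Real.norm_eq_abs,
      abs_sub_comm]
    have := intervalIntegral.norm_integral_le_of_norm_le_const (a := s) (b := t) (C := C * ‖x‖)
      (f := fun u : ℝ => Complex.exp (-z * u) • S.toFun u x) fun u hu => by
        have hu' : u ∈ Icc 0 N := by
          have := uIoc_subset_uIcc hu
          exact ⟨(le_min hs.1 ht.1).trans this.1, this.2.trans (max_le hs.2 ht.2)⟩
        rw [norm_smul]
        calc ‖Complex.exp (-z * u)‖ * ‖S.toFun u x‖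
            ≤ ‖Complex.exp (-z * u)‖ * (m u * ‖x‖) := by
              gcongr
              exact (S.toFun u).le_of_opNorm_le (hS u hu'.1) x
          _ = ‖Complex.exp (-z * u)‖ * m u * ‖x‖ := by ring
          _ ≤ C * ‖x‖ := by
              gcongr
              exact (le_abs_self _).trans (hC u hu')
    linarith
  have hB : ContinuousOn B (Ici 0) := by
    intro s hs
    refine (hlip (s + 1) s ⟨hs, by linarith⟩).mono_of_mem_nhdsWithin ?_
    rw [← Ici_inter_Iic]
    exact inter_mem_nhdsWithin _ (Iic_mem_nhds (by linarith))
  have h2 : ContinuousOn (fun t : ℝ => adjoint (Complex.exp (z * t) • B t) y) (Ici 0) := by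
    have h3 : ContinuousOn (fun t : ℝ => Complex.exp (z * t) • B t) (Ici 0) :=
      (by fun_prop : Continuous fun t : ℝ => Complex.exp (z * t)).continuousOn.smul hB
    exact ((adjoint (𝕜 := ℂ) (E := H) (F := H)).continuous.comp_continuousOn h3).clm_apply
      continuousOn_const
  refine h2.congr fun t _ => ?_
  have : Complex.exp (z * t) • B t = R.comp (S.toFun t) := by
    simp only [B]
    rw [smul_smul, ← Complex.exp_add]
    simp
  simp only [this, ContinuousLinearMap.adjoint_comp, ContinuousLinearMap.comp_apply]

theorem dense_range_adjoint [CompleteSpace H] (hR : IsResolventAt S.generator z R) :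
    DenseRange (adjoint R) := by
  have h := ContinuousLinearMap.orthogonal_ker R
  have hk : R.ker = ⊥ := LinearMap.ker_eq_bot.2 hR.injective
  rw [hk, Submodule.bot_orthogonal_eq_top] at h
  have h2 := Submodule.dense_iff_topologicalClosure_eq_top.2 h.symm
  exact h2

end IsResolventAt

theorem isResolventAt_unboundedResolvent {H : Type*} [NormedAddCommGroup H] [InnerProductSpace ℂ H]
    {A : H →ₗ.[ℂ] H} {z : ℂ} (hz : z ∈ unboundedResolventSet A) :
    IsResolventAt A z (unboundedResolvent A z) := by
  have h : ∃ R : H →L[ℂ] H, IsResolventAt A z R := hz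
  rw [unboundedResolvent, dif_pos h]
  exact Classical.choose_spec h

theorem ResolventBoundedOn.norm_le_inv_resolventRadius {H : Type*} [NormedAddCommGroup H]
    [InnerProductSpace ℂ H] {A : H →ₗ.[ℂ] H} {ω : ℝ} (h : ResolventBoundedOn A ω) {z : ℂ}
    (hz : ω < z.re) : ‖unboundedResolvent A z‖ ≤ (resolventRadius A ω)⁻¹ := by
  obtain ⟨K, hK⟩ := h.2
  rw [resolventRadius, inv_inv]
  refine le_ciSup (f := fun z : {z : ℂ // ω < z.re} => ‖unboundedResolvent A z‖) ?_ ⟨z, hz⟩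
  refine ⟨K, ?_⟩
  rintro _ ⟨w, rfl⟩
  exact hK w w.2.le

theorem ResolventBoundedOn.resolventRadius_pos {H : Type*} [NormedAddCommGroup H]
    [InnerProductSpace ℂ H] [Nontrivial H] {S : StronglyContinuousSemigroup H} {ω : ℝ}
    (h : ResolventBoundedOn S.generator ω) : 0 < resolventRadius S.generator ω := by
  have hz : ω < ((ω + 1 : ℝ) : ℂ).re := by simp
  have hR := isResolventAt_unboundedResolvent (h.1 _ hz.le)
  refine inv_pos.1 (lt_of_lt_of_le ?_ (h.norm_le_inv_resolventRadius hz))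
  rw [norm_pos_iff]
  intro h0
  obtain ⟨x, hx⟩ := exists_ne (0 : H)
  exact hx (hR.injective (by rw [h0]; simp))

/-! ### The bound on the semigroup -/

theorem PiecewiseC1On.isPrimitiveOn {Φ : ℝ → ℝ} {a b : ℝ} (h : PiecewiseC1On Φ a b) :
    IsPrimitiveOn Φ (deriv Φ) a b where
  continuousOn := h.1
  hasDerivAt := by
    obtain ⟨P, hP⟩ := h.2.1
    exact ⟨P, P.countable_toSet, fun s hs => (hP s hs.1 (by simpa using hs.2)).1.hasDerivAt⟩
  measurable := measurable_deriv Φ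
  bounded := by
    refine isCompact_Icc.induction_on (p := fun V => ∃ B, ∀ s ∈ V, |deriv Φ s| ≤ B)
      ⟨0, by simp⟩ (fun V W hVW ⟨B, hB⟩ => ⟨B, fun s hs => hB s (hVW hs)⟩) ?_ fun s hs => ?_
    · rintro V W ⟨B, hB⟩ ⟨C, hC⟩
      exact ⟨max B C, fun s hs => hs.elim (fun h => (hB s h).trans (le_max_left _ _))
        fun h => (hC s h).trans (le_max_right _ _)⟩
    -- Near `s`, the derivative is bounded on each side by means of its one-sided limit.
    · have hbd : ∀ {l : Filter ℝ} {y : ℝ}, Tendsto (deriv Φ) l (𝓝 y) →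
          ∀ᶠ x in l, |deriv Φ x| ≤ |y| + 1 := fun hl =>
        (hl.abs.eventually_lt_const (lt_add_one _)).mono fun _ hx => hx.le
      have hr : ∃ C, ∀ᶠ x in 𝓝[>] s, x ∈ Icc a b → |deriv Φ x| ≤ C := by
        rcases hs.2.eq_or_lt with rfl | hlt
        · refine ⟨0, ?_⟩
          filter_upwards [self_mem_nhdsWithin] with x hx hx'
          exact absurd hx'.2 (not_le.2 hx)
        · obtain ⟨l, hl⟩ := h.2.2.1 s ⟨hs.1, hlt⟩
          exact ⟨_, (hbd hl).mono fun x hx _ => hx⟩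
      have hl : ∃ C, ∀ᶠ x in 𝓝[<] s, x ∈ Icc a b → |deriv Φ x| ≤ C := by
        rcases hs.1.eq_or_lt with rfl | hlt
        · refine ⟨0, ?_⟩
          filter_upwards [self_mem_nhdsWithin] with x hx hx'
          exact absurd hx'.1 (not_le.2 hx)
        · obtain ⟨l, hl⟩ := h.2.2.2 s ⟨hlt, hs.2⟩
          exact ⟨_, (hbd hl).mono fun x hx _ => hx⟩
      obtain ⟨C, hC⟩ := hr
      obtain ⟨D, hD⟩ := hl
      have key : ∀ᶠ x in 𝓝[Icc a b] s, |deriv Φ x| ≤ max (max C D) |deriv Φ s| := by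
        rw [eventually_nhdsWithin_iff] at hC hD ⊢
        filter_upwards [hC, hD] with x hxC hxD hx
        rcases lt_trichotomy x s with hlt | rfl | hlt
        · exact le_max_of_le_left (le_max_of_le_right (hxD hlt hx))
        · exact le_max_right _ _
        · exact le_max_of_le_left (le_max_of_le_left (hxC hlt hx))
      exact ⟨_, key, _, fun x hx => hx⟩

theorem integral_energyDensity_le_weightedNorm {H : Type*} [NormedAddCommGroup H] {U : ℝ → H}
    (hU : ContinuousOn U (Ici 0)) {m : ℝ → ℝ} (hm : ContinuousOn m (Ici 0)) {c : ℝ}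
    (hUm : ∀ s, 0 ≤ s → ‖U s‖ ≤ m s * c) {r ω a : ℝ} (ha : 0 ≤ a) {Φ : ℝ → ℝ}
    (hΦ : IsPrimitiveOn Φ (deriv Φ) 0 a) :
    ∫ s in (0 : ℝ)..a, -((r ^ 2 * Φ s ^ 2 - deriv Φ s ^ 2) * energyDensity U ω s)
      ≤ (weightedNorm ω a (negPartWeight r Φ m) * c) ^ 2 := by
  set w : ℝ → ℝ := fun s => max (-(r ^ 2 * Φ s ^ 2 - deriv Φ s ^ 2)) 0
  have hw : ∀ s, (Real.exp (-ω * s) * negPartWeight r Φ m s) ^ 2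
      = w s * (Real.exp (-ω * s) * m s) ^ 2 := by
    intro s
    rw [negPartWeight, mul_pow, mul_pow, mul_pow, Real.sq_sqrt (le_max_right _ _)]
    ring
  have hwi : IntervalIntegrable w volume 0 a := by
    have h1 : IntervalIntegrable (fun s => -(r ^ 2 * Φ s ^ 2 - deriv Φ s ^ 2)) volume 0 a := by
      refine (IntervalIntegrable.sub (ContinuousOn.intervalIntegrable ?_)
        (hΦ.intervalIntegrable_sq ha)).neg
      rw [uIcc_of_le ha]
      exact continuousOn_const.mul (hΦ.continuousOn.pow 2)
    rw [intervalIntegrable_iff_integrableOn_Ioc_of_le ha] at h1 ⊢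
    exact Integrable.pos_part h1
  have hmi : IntervalIntegrable (fun s => w s * (Real.exp (-ω * s) * m s) ^ 2) volume 0 a := by
    refine hwi.mul_continuousOn ?_
    rw [uIcc_of_le ha]
    exact (((by fun_prop : Continuous fun s : ℝ => Real.exp (-ω * s)).continuousOn).mul
      (hm.mono Icc_subset_Ici_self)).pow 2
  rw [mul_pow, weightedNorm, Real.sq_sqrt
    (intervalIntegral.integral_nonneg ha fun s _ => sq_nonneg _), mul_comm,
    ← intervalIntegral.integral_const_mul]
  simp_rw [hw]
  refine intervalIntegral.integral_mono_on ha
    (hΦ.intervalIntegrable_mul_energyDensity hU ω r ha).neg (hmi.const_mul _) fun s hs => ?_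
  calc -((r ^ 2 * Φ s ^ 2 - deriv Φ s ^ 2) * energyDensity U ω s)
      ≤ w s * energyDensity U ω s := by
        rw [← neg_mul]
        exact mul_le_mul_of_nonneg_right (le_max_left _ _) (energyDensity_nonneg _ _ _)
    _ ≤ w s * (Real.exp (-ω * s) * (m s * c)) ^ 2 := by
        refine mul_le_mul_of_nonneg_left ?_ (le_max_right _ _)
        exact pow_le_pow_left₀ (by positivity)
          (mul_le_mul_of_nonneg_left (hUm s hs.1) (Real.exp_pos _).le) 2
    _ = c ^ 2 * (w s * (Real.exp (-ω * s) * m s) ^ 2) := by ring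

/-- The energy inequality for the weight `Φ` on `[0, a]`, continued by `Φ(a) e^{κ (s - a)}` on
`[a, d]`. Only the negative part of `r² Φ² - Φ'²` is retained on `[0, a]`, so the sign condition on
this function is not needed. -/
theorem integral_exp_mul_energyDensity_le {H : Type*} [NormedAddCommGroup H]
    [InnerProductSpace ℂ H] [CompleteSpace H] {U : ℝ → H} (hU : ContinuousOn U (Ici 0))
    {R : ℂ → H →L[ℂ] H} {r ω M ω₀ : ℝ} (hr : 0 < r)
    (hRr : ∀ z : ℂ, ω < z.re → ‖R z‖ ≤ r⁻¹)
    (hR : ∀ z : ℂ, ω < z.re → IsResolventOfOrbit (R z) z U)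
    (hM : ∀ s, 0 ≤ s → ‖U s‖ ≤ M * Real.exp (ω₀ * s))
    {m : ℝ → ℝ} (hm : ContinuousOn m (Ici 0)) {c : ℝ}
    (hUm : ∀ s, 0 ≤ s → ‖U s‖ ≤ m s * c) {a d : ℝ} (ha : 0 ≤ a) (had : a ≤ d)
    {Φ : ℝ → ℝ} (hΦ : IsPrimitiveOn Φ (deriv Φ) 0 a) (h0 : Φ 0 = 0) (κ : ℝ) :
    (r ^ 2 - κ ^ 2) * Φ a ^ 2 *
        ∫ s in a..d, (Real.exp (κ * (s - a)) * (Real.exp (-ω * s) * ‖U s‖)) ^ 2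
      ≤ (weightedNorm ω a (negPartWeight r Φ m) * c) ^ 2 := by
  have hd : 0 ≤ d := ha.trans had
  set χ₂ : ℝ → ℝ := fun s => Φ a * Real.exp (κ * (s - a))
  set g₂ : ℝ → ℝ := fun s => Φ a * (Real.exp (κ * (s - a)) * κ)
  have hχ₂ : IsPrimitiveOn χ₂ g₂ a d := by
    refine IsPrimitiveOn.of_hasDerivAt (fun s => ?_) (by fun_prop) a d
    have h1 : HasDerivAt (fun s : ℝ => κ * (s - a)) κ s := by
      simpa using ((hasDerivAt_id s).sub_const a).const_mul κ
    exact h1.exp.const_mul _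
  have hglue := hΦ.glue hχ₂ ha had (by simp [χ₂])
  have key := integral_weight_mul_energyDensity_nonpos hU hr hRr hR hM hd hglue (by simp [ha, h0])
  have hint := hglue.intervalIntegrable_mul_energyDensity hU ω r hd
  have hsub1 : uIcc 0 a ⊆ uIcc 0 d := by
    rw [uIcc_of_le ha, uIcc_of_le hd]; exact Icc_subset_Icc_right had
  have hsub2 : uIcc a d ⊆ uIcc 0 d := by
    rw [uIcc_of_le had, uIcc_of_le hd]; exact Icc_subset_Icc_left ha
  rw [← intervalIntegral.integral_add_adjacent_intervals (hint.mono_set hsub1)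
    (hint.mono_set hsub2)] at key
  have e1 : ∫ s in (0 : ℝ)..a, (r ^ 2 * (if s ≤ a then Φ s else χ₂ s) ^ 2 -
      (if s ≤ a then deriv Φ s else g₂ s) ^ 2) * energyDensity U ω s
      = ∫ s in (0 : ℝ)..a, (r ^ 2 * Φ s ^ 2 - deriv Φ s ^ 2) * energyDensity U ω s := by
    refine intervalIntegral.integral_congr fun s hs => ?_
    rw [uIcc_of_le ha] at hs
    simp [hs.2]
  have e2 : ∫ s in a..d, (r ^ 2 * (if s ≤ a then Φ s else χ₂ s) ^ 2 -
      (if s ≤ a then deriv Φ s else g₂ s) ^ 2) * energyDensity U ω s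
      = (r ^ 2 - κ ^ 2) * Φ a ^ 2 *
        ∫ s in a..d, (Real.exp (κ * (s - a)) * (Real.exp (-ω * s) * ‖U s‖)) ^ 2 := by
    rw [← intervalIntegral.integral_const_mul]
    refine intervalIntegral.integral_congr_Ioo_of_le had fun s hs => ?_
    simp only [not_le.2 hs.1, if_false, χ₂, g₂, energyDensity]
    ring
  have h3 := integral_energyDensity_le_weightedNorm hU hm hUm (r := r) (ω := ω) ha hΦ
  rw [intervalIntegral.integral_neg] at h3
  rw [e1, e2] at key
  linarith

theorem sq_integral_mul_le {F G : ℝ → ℝ} {a b : ℝ} (hab : a ≤ b) (hF : ContinuousOn F (Icc a b))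
    (hG : ContinuousOn G (Icc a b)) :
    (∫ s in a..b, F s * G s) ^ 2 ≤ (∫ s in a..b, F s ^ 2) * ∫ s in a..b, G s ^ 2 := by
  rw [← uIcc_of_le hab] at hF hG
  have hFF : IntervalIntegrable (fun s => F s ^ 2) volume a b := (hF.pow 2).intervalIntegrable
  have hGG : IntervalIntegrable (fun s => G s ^ 2) volume a b := (hG.pow 2).intervalIntegrable
  have hFG : IntervalIntegrable (fun s => F s * G s) volume a b :=
    (hF.mul hG).intervalIntegrable
  have h : ∀ k : ℝ, 0 ≤ (∫ s in a..b, F s ^ 2) * (k * k) + (2 * ∫ s in a..b, F s * G s) * k +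
      ∫ s in a..b, G s ^ 2 := by
    intro k
    have h1 : 0 ≤ ∫ s in a..b, (k * F s + G s) ^ 2 :=
      intervalIntegral.integral_nonneg hab fun s _ => sq_nonneg _
    have h2 : ∫ s in a..b, (k * F s + G s) ^ 2
        = ∫ s in a..b, (k * k * F s ^ 2 + 2 * k * (F s * G s) + G s ^ 2) := by
      congr 1; funext s; ring
    rw [h2, intervalIntegral.integral_add ((hFF.const_mul _).add (hFG.const_mul _)) hGG,
      intervalIntegral.integral_add (hFF.const_mul _) (hFG.const_mul _),
      intervalIntegral.integral_const_mul, intervalIntegral.integral_const_mul] at h1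
    linarith
  have := discrim_le_zero h
  rw [discrim] at this
  linarith

/-- The bound on the matrix coefficients of `S(t)`, for vectors `y` whose orbit under the adjoint
semigroup is continuous. -/
theorem norm_inner_mul_Jmax_le {H : Type*} [NormedAddCommGroup H] [InnerProductSpace ℂ H]
    [CompleteSpace H] [Nontrivial H] {S : StronglyContinuousSemigroup H} {ω r : ℝ}
    {m : ℝ → ℝ} {a b : ℝ} {Φ Ψ : ℝ → ℝ} (h : ResolventBoundedOn S.generator ω)
    (hr : r = resolventRadius S.generator ω) (hm : ContinuousOn m (Ici 0))
    (hS : ∀ t, 0 ≤ t → ‖S.toFun t‖ ≤ m t) (ha : 0 < a) (hb : 0 < b)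
    (hΦ : IsAdmissibleWeight r a Φ) (hΨ : IsAdmissibleWeight r b Ψ) {t : ℝ} (ht : a + b < t)
    (x y : H) (hy : ContinuousOn (fun s => adjoint (S.toFun s) y) (Ici 0)) :
    Real.exp (-ω * t) * ‖inner ℂ y (S.toFun t x)‖ * (Jmax r (t - a - b) * Φ a * Ψ b)
      ≤ weightedNorm ω a (negPartWeight r Φ m) * weightedNorm ω b (negPartWeight r Ψ m) *
        (‖x‖ * ‖y‖) := by
  have hr0 : 0 < r := hr ▸ h.resolventRadius_pos
  have hres : ∀ z : ℂ, ω ≤ z.re → IsResolventAt S.generator z (unboundedResolvent S.generator z) :=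
    fun z hz => isResolventAt_unboundedResolvent (h.1 z hz)
  have hRr : ∀ z : ℂ, ω < z.re → ‖unboundedResolvent S.generator z‖ ≤ r⁻¹ :=
    fun z hz => hr ▸ h.norm_le_inv_resolventRadius hz
  obtain ⟨M, ω₀, hM⟩ := S.exists_norm_le_exp hm hS
  set τ := t - a - b with hτ
  have hτ0 : 0 < τ := by linarith
  set q := Real.sqrt (1 + (r * τ) ^ 2)
  have hq2 : q ^ 2 = 1 + (r * τ) ^ 2 := Real.sq_sqrt (by positivity)
  have hq0 : 0 ≤ q := Real.sqrt_nonneg _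
  have hq1 : 1 < q := by nlinarith [mul_pos hr0 hτ0]
  -- This is the maximum point of `(r² - κ²) τ e^{κ τ}`, where `(r² - κ²) τ = 2 κ`.
  set κ := (q - 1) / τ with hκ
  have hκ0 : 0 < κ := div_pos (by linarith) hτ0
  have hκτ : κ * τ = q - 1 := div_mul_cancel₀ _ hτ0.ne'
  have hkey : (r ^ 2 - κ ^ 2) * τ = 2 * κ := by
    have : ((r ^ 2 - κ ^ 2) * τ) * τ = 2 * κ * τ := by
      have h1 : (κ * τ) ^ 2 = (q - 1) ^ 2 := by rw [hκτ]
      nlinarith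
    exact mul_right_cancel₀ hτ0.ne' this
  have hrκ : 0 < r ^ 2 - κ ^ 2 := by
    by_contra hneg
    have := mul_nonpos_of_nonpos_of_nonneg (not_lt.1 hneg) hτ0.le
    linarith
  have hJ : Jmax r τ = Real.exp (κ * τ) * ((r ^ 2 - κ ^ 2) * τ) := by
    rw [hkey, hκτ, Jmax, hκ]
    ring
  have hΦa := hΦ.pos a ⟨ha, le_rfl⟩
  have hΨb := hΨ.pos b ⟨hb, le_rfl⟩
  set V : ℝ → H := fun s => adjoint (S.toFun s) y
  set U : ℝ → H := fun s => S.toFun s x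
  have hU : ContinuousOn U (Ici 0) := S.continuousOn x
  have hadj : ∀ s, ‖V s‖ ≤ ‖S.toFun s‖ * ‖y‖ := fun s => by
    rw [← LinearIsometryEquiv.norm_map adjoint (S.toFun s)]
    exact ContinuousLinearMap.le_opNorm _ _
  have hUS : ∀ s, ‖U s‖ ≤ ‖S.toFun s‖ * ‖x‖ := fun s => ContinuousLinearMap.le_opNorm _ _
  have bU := integral_exp_mul_energyDensity_le hU hr0 hRr
    (fun z hz => (hres z hz.le).isResolventOfOrbit x)
    (M := M * ‖x‖) (ω₀ := ω₀)
    (fun s hs => (hUS s).trans (by nlinarith [hM s hs, norm_nonneg x])) hm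
    (fun s hs => (hUS s).trans (mul_le_mul_of_nonneg_right (hS s hs) (norm_nonneg x)))
    ha.le (by linarith : a ≤ t - b) hΦ.piecewiseC1.isPrimitiveOn hΦ.map_zero κ
  have bV := integral_exp_mul_energyDensity_le hy hr0
    (R := fun z => adjoint (unboundedResolvent S.generator (starRingEnd ℂ z)))
    (fun z hz => by
      rw [LinearIsometryEquiv.norm_map]
      exact hRr _ (by simpa using hz))
    (fun z hz => by
      have := (hres (starRingEnd ℂ z) (by simpa using hz.le)).isResolventOfOrbit_adjoint hy
      rwa [Complex.conj_conj] at this)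
    (M := M * ‖y‖) (ω₀ := ω₀)
    (fun s hs => (hadj s).trans (by nlinarith [hM s hs, norm_nonneg y])) hm
    (fun s hs => (hadj s).trans (mul_le_mul_of_nonneg_right (hS s hs) (norm_nonneg y)))
    hb.le (by linarith : b ≤ t - a) hΨ.piecewiseC1.isPrimitiveOn hΨ.map_zero κ
  set NΦ := weightedNorm ω a (negPartWeight r Φ m)
  set NΨ := weightedNorm ω b (negPartWeight r Ψ m)
  have hNΦ : 0 ≤ NΦ := Real.sqrt_nonneg _
  have hNΨ : 0 ≤ NΨ := Real.sqrt_nonneg _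
  set F : ℝ → ℝ := fun s => Real.exp (κ * (s - a)) * (Real.exp (-ω * s) * ‖U s‖)
  set G : ℝ → ℝ := fun s => Real.exp (κ * (s - b)) * (Real.exp (-ω * s) * ‖V s‖)
  have hF : ContinuousOn F (Ici 0) :=
    (by fun_prop : Continuous fun s => Real.exp (κ * (s - a))).continuousOn.mul
      ((by fun_prop : Continuous fun s => Real.exp (-ω * s)).continuousOn.mul hU.norm)
  have hG : ContinuousOn G (Ici 0) :=
    (by fun_prop : Continuous fun s => Real.exp (κ * (s - b))).continuousOn.mul
      ((by fun_prop : Continuous fun s => Real.exp (-ω * s)).continuousOn.mul hy.norm)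
  have hF' : ContinuousOn F (Icc a (t - b)) := hF.mono fun s hs => ha.le.trans hs.1
  have hG' : ContinuousOn (fun s => G (t - s)) (Icc a (t - b)) :=
    hG.comp (by fun_prop) fun s hs => by
      have := hs.2
      simp only [mem_Ici]
      linarith
  have hab : a ≤ t - b := by linarith
  have hcs := sq_integral_mul_le hab hF' hG'
  have hrefl : ∫ s in a..(t - b), G (t - s) ^ 2 = ∫ s in b..(t - a), G s ^ 2 := by
    rw [intervalIntegral.integral_comp_sub_left (fun s => G s ^ 2) t,
      show t - (t - b) = b by ring]
  rw [hrefl] at hcs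
  set p := Real.exp (κ * τ) * (Real.exp (-ω * t) * ‖inner ℂ y (S.toFun t x)‖)
  have hp0 : 0 ≤ p := by positivity
  have hpFG : ∀ s ∈ Icc a (t - b), p ≤ F s * G (t - s) := by
    intro s hs
    have hs0 : 0 ≤ s := ha.le.trans hs.1
    have hts : 0 ≤ t - s := by linarith [hs.2]
    -- The pairing of the orbit with the time-reversed adjoint orbit does not depend on `s`.
    have h1 : inner ℂ y (S.toFun t x) = inner ℂ (V (t - s)) (U s) := by
      have := S.map_add (t - s) s hts hs0
      rw [sub_add_cancel] at this
      rw [this, ContinuousLinearMap.adjoint_inner_left, ContinuousLinearMap.comp_apply]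
    have h2 : Real.exp (κ * τ) = Real.exp (κ * (s - a)) * Real.exp (κ * (t - s - b)) := by
      rw [← Real.exp_add, hτ]; congr 1; ring
    have h3 : Real.exp (-ω * t) = Real.exp (-ω * s) * Real.exp (-ω * (t - s)) := by
      rw [← Real.exp_add]; congr 1; ring
    calc p ≤ Real.exp (κ * τ) * (Real.exp (-ω * t) * (‖V (t - s)‖ * ‖U s‖)) := by
          simp only [p]
          rw [h1]
          gcongr
          exact norm_inner_le_norm _ _
      _ = F s * G (t - s) := by rw [h2, h3]; simp only [F, G]; ring
  have hint : p * τ ≤ ∫ s in a..(t - b), F s * G (t - s) := by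
    have h1 : ∫ _ in a..(t - b), p = p * τ := by
      rw [intervalIntegral.integral_const, smul_eq_mul, hτ]; ring
    rw [← h1]
    refine intervalIntegral.integral_mono_on hab (by simp) ?_ hpFG
    refine ContinuousOn.intervalIntegrable ?_
    rw [uIcc_of_le hab]
    exact hF'.mul hG'
  have hfin : p * τ * ((r ^ 2 - κ ^ 2) * (Φ a * Ψ b)) ≤ NΦ * ‖x‖ * (NΨ * ‖y‖) := by
    refine le_of_sq_le_sq ?_ (by positivity)
    calc (p * τ * ((r ^ 2 - κ ^ 2) * (Φ a * Ψ b))) ^ 2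
        = (p * τ) ^ 2 * ((r ^ 2 - κ ^ 2) * (Φ a * Ψ b)) ^ 2 := by ring
      _ ≤ ((∫ s in a..(t - b), F s ^ 2) * ∫ s in b..(t - a), G s ^ 2) *
            ((r ^ 2 - κ ^ 2) * (Φ a * Ψ b)) ^ 2 := by
          refine mul_le_mul_of_nonneg_right ?_ (sq_nonneg _)
          exact (pow_le_pow_left₀ (by positivity) hint 2).trans hcs
      _ = ((r ^ 2 - κ ^ 2) * Φ a ^ 2 * ∫ s in a..(t - b), F s ^ 2) *
            ((r ^ 2 - κ ^ 2) * Ψ b ^ 2 * ∫ s in b..(t - a), G s ^ 2) := by ring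
      _ ≤ (NΦ * ‖x‖) ^ 2 * (NΨ * ‖y‖) ^ 2 := by
          refine mul_le_mul bU bV ?_ (sq_nonneg _)
          refine mul_nonneg (by positivity) (intervalIntegral.integral_nonneg (by linarith)
            fun s _ => sq_nonneg _)
      _ = (NΦ * ‖x‖ * (NΨ * ‖y‖)) ^ 2 := by ring
  rw [hJ]
  simp only [p] at hfin
  linarith

theorem exp_mul_norm_toFun_le {H : Type*} [NormedAddCommGroup H] [InnerProductSpace ℂ H]
    [CompleteSpace H] [Nontrivial H] {S : StronglyContinuousSemigroup H} {ω r : ℝ}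
    {m : ℝ → ℝ} {a b : ℝ} {Φ Ψ : ℝ → ℝ} (h : ResolventBoundedOn S.generator ω)
    (hr : r = resolventRadius S.generator ω) (hm : ContinuousOn m (Ici 0))
    (hS : ∀ t, 0 ≤ t → ‖S.toFun t‖ ≤ m t) (ha : 0 < a) (hb : 0 < b)
    (hΦ : IsAdmissibleWeight r a Φ) (hΨ : IsAdmissibleWeight r b Ψ) {t : ℝ} (ht : a + b < t)
    (hJ : 0 < Jmax r (t - a - b)) :
    Real.exp (-ω * t) * ‖S.toFun t‖ ≤
      weightedNorm ω a (negPartWeight r Φ m) * weightedNorm ω b (negPartWeight r Ψ m) /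
        (Jmax r (t - a - b) * Φ a * Ψ b) := by
  set D := Jmax r (t - a - b) * Φ a * Ψ b
  have hD : 0 < D := mul_pos (mul_pos hJ (hΦ.pos a ⟨ha, le_rfl⟩)) (hΨ.pos b ⟨hb, le_rfl⟩)
  set N := weightedNorm ω a (negPartWeight r Φ m) * weightedNorm ω b (negPartWeight r Ψ m)
  have hN : 0 ≤ N := mul_nonneg (Real.sqrt_nonneg _) (Real.sqrt_nonneg _)
  have hres := isResolventAt_unboundedResolvent (h.1 (ω : ℂ) (by simp))
  have hinner : ∀ x y : H,
      Real.exp (-ω * t) * ‖inner ℂ y (S.toFun t x)‖ * D ≤ N * (‖x‖ * ‖y‖) := by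
    intro x y
    refine hres.dense_range_adjoint.induction_on
      (p := fun y => Real.exp (-ω * t) * ‖inner ℂ y (S.toFun t x)‖ * D ≤ N * (‖x‖ * ‖y‖)) y
      (isClosed_le (by fun_prop) (by fun_prop)) fun v => ?_
    exact norm_inner_mul_Jmax_le h hr hm hS ha hb hΦ hΨ ht x _
      (hres.continuousOn_adjoint hm hS v)
  have hE := Real.exp_pos (-ω * t)
  have hop : ‖S.toFun t‖ ≤ N / (D * Real.exp (-ω * t)) := by
    refine ContinuousLinearMap.opNorm_le_bound _ (by positivity) fun x => ?_
    rcases eq_or_ne (S.toFun t x) 0 with h0 | h0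
    · rw [h0, norm_zero]; positivity
    have h1 := hinner x (S.toFun t x)
    rw [inner_self_eq_norm_sq_to_K] at h1
    simp only [norm_pow, RCLike.norm_ofReal, abs_norm] at h1
    have h2 := norm_pos_iff.2 h0
    rw [div_mul_eq_mul_div, le_div_iff₀ (by positivity)]
    refine le_of_mul_le_mul_right ?_ h2
    linarith
  rw [le_div_iff₀ (by positivity)] at hop ⊢
  linarith

/-! ### Asymptotics of `Jmax` -/

theorem Jmax_div_bounds {r t : ℝ} (hr : 0 < r) (ht : 0 < t) (h1 : 1 ≤ r * t) :
    |Jmax r t / (2 / Real.exp 1 * Real.exp (r * t) * r) - 1| ≤ 1 / (r * t) := by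
  set y := r * t with hy
  have hy0 : 0 < y := by linarith
  set q := Real.sqrt (1 + y ^ 2) with hq
  have hq2 : q ^ 2 = 1 + y ^ 2 := Real.sq_sqrt (by positivity)
  have hq0 : 0 ≤ q := Real.sqrt_nonneg _
  have hyq : y ≤ q := by nlinarith
  set δ := q - y
  have hδ0 : 0 ≤ δ := sub_nonneg.2 hyq
  have hδ : δ * (2 * y) ≤ 1 := by simp only [δ]; nlinarith
  have hδ1 : δ ≤ 1 / 2 := by nlinarith
  -- The quotient is `e^δ (q - 1) / y` with `δ = √(1 + y²) - y ≤ 1 / (2 y)`.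
  have heq : Jmax r t / (2 / Real.exp 1 * Real.exp y * r) = Real.exp δ * ((q - 1) / y) := by
    have h2 : Real.exp (q - 1) * Real.exp 1 = Real.exp δ * Real.exp y := by
      rw [← Real.exp_add, ← Real.exp_add]
      congr 1
      simp only [δ]; ring
    rw [Jmax, ← hy, ← hq, hy]
    rw [← hy]
    have he := Real.exp_pos 1
    have he2 := Real.exp_pos y
    field_simp
    rw [hy]
    linear_combination t * r * (q - 1) * h2
  rw [heq]
  have hlow : 1 ≤ Real.exp δ := Real.one_le_exp hδ0
  have hexp : Real.exp δ ≤ 1 + 2 * δ := by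
    have := Real.abs_exp_sub_one_le (x := δ) (by rw [abs_of_nonneg hδ0]; linarith)
    rw [abs_of_nonneg hδ0, abs_of_nonneg (by linarith)] at this
    linarith
  have hdy : 2 * δ ≤ 1 / y := by rw [le_div_iff₀ hy0]; linarith
  have hq1 : (q - 1) / y ≤ 1 := by rw [div_le_one hy0]; linarith
  have hq1' : 1 - 1 / y ≤ (q - 1) / y := by
    rw [show 1 - 1 / y = (y - 1) / y by field_simp]
    gcongr
  have hq1'' : 0 ≤ (q - 1) / y := div_nonneg (by linarith) hy0.le
  rw [abs_le]
  constructor <;> nlinarith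

end

theorem propositionA1 :
    ∃ C X : ℝ, 0 < C ∧ 0 < X ∧
      -- asymptotics of `J_max`, uniform in `r`
      (∀ r t : ℝ, 0 < r → 0 < t → X ≤ r * t →
        |Jmax r t / (2 / Real.exp 1 * Real.exp (r * t) * r) - 1| ≤ C / (r * t)) ∧
      ∀ (H : Type*) [NormedAddCommGroup H] [InnerProductSpace ℂ H] [CompleteSpace H]
        [Nontrivial H] (S : StronglyContinuousSemigroup H) (ω : ℝ) (m : ℝ → ℝ) (a b : ℝ)
        (Φ Ψ : ℝ → ℝ) (r : ℝ),
        ResolventBoundedOn S.generator ω →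
        r = resolventRadius S.generator ω →
        ContinuousOn m (Set.Ici 0) →
        (∀ t, 0 ≤ t → 0 < m t) →
        (∀ t, 0 ≤ t → ‖S.toFun t‖ ≤ m t) →
        0 < a → 0 < b →
        IsAdmissibleWeight r a Φ →
        IsAdmissibleWeight r b Ψ →
        ∀ t : ℝ, a + b < t →
          -- the bound with `J_max`
          Real.exp (-ω * t) * ‖S.toFun t‖ ≤
            weightedNorm ω a (negPartWeight r Φ m) * weightedNorm ω b (negPartWeight r Ψ m) /
              (Jmax r (t - a - b) * Φ a * Ψ b) ∧
          -- its asymptotic form for large `r (t - a - b)`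
          (X ≤ r * (t - a - b) →
            Real.exp (-ω * t) * ‖S.toFun t‖ ≤
              (1 + C / (r * (t - a - b))) *
                (Real.exp 1 / (2 * r) * Real.exp (-r * (t - a - b))) *
                (weightedNorm ω a (negPartWeight r Φ m) * weightedNorm ω b (negPartWeight r Ψ m) /
                  (Φ a * Ψ b))) := by
  refine ⟨2, 2, by norm_num, by norm_num, fun r t hr ht hrt => ?_, ?_⟩
  · refine (Jmax_div_bounds hr ht (by linarith)).trans ?_
    gcongr
    norm_num
  intro H _ _ _ _ S ω m a b Φ Ψ r h hr hm _ hS ha hb hΦ hΨ t ht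
  have hr0 : 0 < r := hr ▸ h.resolventRadius_pos
  set τ := t - a - b
  have hτ0 : 0 < τ := by simp only [τ]; linarith
  have hJ : 0 < Jmax r τ := by
    have : 1 < Real.sqrt (1 + (r * τ) ^ 2) := by
      rw [Real.lt_sqrt zero_le_one]
      have := pow_pos (mul_pos hr0 hτ0) 2
      linarith
    exact mul_pos (mul_pos (Real.exp_pos _) (by positivity)) (by linarith)
  have hmain := exp_mul_norm_toFun_le h hr hm hS ha hb hΦ hΨ ht hJ
  refine ⟨hmain, fun hX => hmain.trans ?_⟩
  set N := weightedNorm ω a (negPartWeight r Φ m) * weightedNorm ω b (negPartWeight r Ψ m)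
  have hN : 0 ≤ N := mul_nonneg (Real.sqrt_nonneg _) (Real.sqrt_nonneg _)
  have hΦa := hΦ.pos a ⟨ha, le_rfl⟩
  have hΨb := hΨ.pos b ⟨hb, le_rfl⟩
  have hJb := (abs_le.1 (Jmax_div_bounds hr0 hτ0 (by linarith))).1
  set E := 2 / Real.exp 1 * Real.exp (r * τ) * r with hE
  have hE0 : 0 < E := by positivity
  have hρ : 1 - 1 / (r * τ) ≤ Jmax r τ / E := by linarith
  rw [le_div_iff₀ hE0] at hρ
  set y := r * τ with hy
  have hinv : 1 / Jmax r τ ≤ (1 + 2 / y) * (1 / E) := by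
    rw [div_le_iff₀ hJ]
    have h1 : 1 ≤ (1 + 2 / y) * (1 - 1 / y) := by
      have : (1 + 2 / y) * (1 - 1 / y) = 1 + (y - 2) / y ^ 2 := by
        field_simp
        ring
      rw [this]
      have : 0 ≤ (y - 2) / y ^ 2 := div_nonneg (by linarith) (sq_nonneg _)
      linarith
    have h2 : (1 + 2 / y) * (1 - 1 / y) ≤ (1 + 2 / y) * (1 / E) * Jmax r τ := by
      rw [mul_assoc]
      refine mul_le_mul_of_nonneg_left ?_ (by positivity)
      rw [one_div_mul_eq_div, le_div_iff₀ hE0]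
      exact hρ
    exact h1.trans h2
  have hE' : 1 / E = Real.exp 1 / (2 * r) * Real.exp (-r * τ) := by
    rw [hE, neg_mul, ← hy, Real.exp_neg]
    field_simp
  rw [← hE']
  calc N / (Jmax r τ * Φ a * Ψ b) = 1 / Jmax r τ * (N / (Φ a * Ψ b)) := by field_simp
    _ ≤ _ := mul_le_mul_of_nonneg_right hinv (by positivity)
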